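/- Let $n \ge 0$ be an integer and let $\Phi_0$ be a real-valued, strictly plurisubharmonic quadratic form on $\mathbf{C}^n \simeq \mathbf{R}^{2n}$, i.e. the matrix $(\partial^2\Phi_0/\partial\overline{x}_j\partial x_k)_{j,k}$ is positive definite. Let $$ \Lambda_{\Phi_0} = \Big\{\Big(x, \tfrac{2}{i}\tfrac{\partial \Phi_0}{\partial x}(x)\Big) : x \in \mathbf{C}^n\Big\} \subset \mathbf{C}^n_x\times\mathbf{C}^n_\xi , $$ let $\sigma = \sum_{j=1}^n d\xi_j\wedge dx_j$ be the complex symplectic form on $\mathbf{C}^{2n}$ (real and non-degenerate on $\Lambda_{\Phi_0}$), and let $dX$ be the symplectic volume $\sigma^n/n!$ on $\Lambda_{\Phi_0}$. For $s>1$, $\mathcal{G}^s_b(\mathbf{R}^m)$ is the space of all $u\in C^\infty(\mathbf{R}^m)$ for which there are $A, C>0$ with $|\partial^\alpha u(x)| \le A\, C^{|\alpha|}(\alpha!)^s$ for all $\alpha\in\mathbf{N}^m$, $x\in\mathbf{R}^m$; and $\mathcal{G}^s_b(\Lambda_{\Phi_0})$ is the corresponding space on $\Lambda_{\Phi_0}$,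 identified with $\mathbf{C}^n\simeq\mathbf{R}^{2n}$ by the projection $(x,\xi)\mapsto x$. Symbols may depend on the semiclassical parameter $h\in(0,1]$; they are then said to belong to $\mathcal{G}^s_b(\Lambda_{\Phi_0})$ if the estimates hold with constants $A, C$ independent of $h$. Let $a, b\in \mathcal{G}^s_b(\Lambda_{\Phi_0})$ for some $s>1$. Then, for all $h \in (0,1]$ and $X\in\Lambda_{\Phi_0}$, the Weyl composition $$ c(X) = (a\# b)(X) = \frac{1}{(\pi h)^{2n}} \iint_{\Lambda_{\Phi_0}\times\Lambda_{\Phi_0}} e^{-2i\sigma(Y,Z)/h}\, a(X+Y)\, b(X+Z)\, dY\, dZ $$ is well defined as an oscillatory integral, that is, as the limit as $\varepsilon\to 0^+$ of the integrals with the factor $\chi(\varepsilon Y,\varepsilon Z)$ inserted, which exists and is the same for every Schwartz function $\chi$ on $\Lambda_{\Phi_0}\times\Lambda_{\Phi_0}$ with $\chi(0)=1$. Moreover $c\in\mathcal{G}^s_b(\Lambda_{\Phi_0})$, with constants independent of $h\in(0,1]$. -/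

import Mathlib

open scoped ContDiff Topology ComplexOrder

noncomputable section

namespace GevreyWeyl

/-! ### Gevrey classes on `ℝ^ι` -/

/-- `u ∈ C^∞(ℝ^ι)` and `|∂^α u(x)| ≤ A C^{|α|} (α!)^s` for all multi-indices `α` and all `x`.

A multi-index `α` of length `k` is presented by a sequence `j₁, …, j_k` of coordinate indices,
`α i = #{l | j l = i}`. For smooth `u` the value of the `k`-th derivative on the coordinate vectors
`e_{j₁}, …, e_{j_k}` is `∂_{j₁} ⋯ ∂_{j_k} u(x) = ∂^α u(x)`, and `α! = ∏ i, (α i)!`. -/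
def GevreyBound {ι : Type*} [Fintype ι] [DecidableEq ι] (s A C : ℝ) (u : (ι → ℝ) → ℂ) : Prop :=
  ContDiff ℝ ∞ u ∧
    ∀ (k : ℕ) (j : Fin k → ι) (x : ι → ℝ),
      ‖iteratedFDeriv ℝ k u x (fun l => Pi.single (j l) (1 : ℝ))‖ ≤
        A * C ^ k * ((∏ i, (Finset.univ.filter fun l => j l = i).card.factorial : ℕ) : ℝ) ^ s

/-! ### Complex derivatives and strict plurisubharmonicity on `ℂⁿ` -/

variable {n : ℕ}

/-- `∂f/∂x_k = ½ (∂f/∂(Re x_k) - i ∂f/∂(Im x_k))`. -/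
def dHol (k : Fin n) (f : (Fin n → ℂ) → ℂ) (x : Fin n → ℂ) : ℂ :=
  (1 / 2) * (fderiv ℝ f x (Pi.single k 1) - Complex.I * fderiv ℝ f x (Pi.single k Complex.I))

/-- `∂f/∂x̄_k = ½ (∂f/∂(Re x_k) + i ∂f/∂(Im x_k))`. -/
def dAntihol (k : Fin n) (f : (Fin n → ℂ) → ℂ) (x : Fin n → ℂ) : ℂ :=
  (1 / 2) * (fderiv ℝ f x (Pi.single k 1) + Complex.I * fderiv ℝ f x (Pi.single k Complex.I))

/-- The Levi matrix `Φ''_{x̄x}(x) = (∂²Φ/∂x̄_j∂x_k (x))_{j,k}`. -/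
def leviMatrix (Φ : (Fin n → ℂ) → ℝ) (x : Fin n → ℂ) : Matrix (Fin n) (Fin n) ℂ :=
  Matrix.of fun j k => dAntihol j (dHol k fun y => (Φ y : ℂ)) x

/-- A `C²` function on `ℂⁿ` is strictly plurisubharmonic if its Levi matrix is positive definite
at every point. -/
def StrictlyPlurisubharmonic (Φ : (Fin n → ℂ) → ℝ) : Prop :=
  ContDiff ℝ 2 Φ ∧ ∀ x, (leviMatrix Φ x).PosDef

/-! ### The subspace `Λ_Φ` and its symplectic geometry -/

lemma fderiv_quadraticForm (Φ : QuadraticForm ℝ (Fin n → ℂ)) (x v : Fin n → ℂ) :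
    fderiv ℝ (fun y => (Φ y : ℂ)) x v = ((QuadraticMap.polar Φ x v : ℝ) : ℂ) := by
  obtain ⟨B, hB⟩ := LinearMap.BilinMap.toQuadraticMap_surjective (R := ℝ) Φ
  let B' : (Fin n → ℂ) →L[ℝ] (Fin n → ℂ) →L[ℝ] ℝ :=
    LinearMap.toContinuousLinearMap
      ((LinearMap.toContinuousLinearMap :
        ((Fin n → ℂ) →ₗ[ℝ] ℝ) ≃ₗ[ℝ] ((Fin n → ℂ) →L[ℝ] ℝ)).toLinearMap ∘ₗ B)
  have hB' : ∀ y z, B' y z = B y z := fun _ _ => rfl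
  have h1 : HasFDerivAt (fun y => B' y y) (B' x + B'.flip x) x := by
    have := B'.hasFDerivAt_of_bilinear (hasFDerivAt_id x) (hasFDerivAt_id x)
    refine this.congr_fderiv ?_
    ext w
    simp
  have h2 : HasFDerivAt (fun y => ((B' y y : ℝ) : ℂ))
      (Complex.ofRealCLM.comp (B' x + B'.flip x)) x :=
    Complex.ofRealCLM.hasFDerivAt.comp x h1
  have h3 : (fun y => (Φ y : ℂ)) = fun y => ((B' y y : ℝ) : ℂ) := by
    funext y
    simp [hB', ← hB]
  rw [h3, h2.fderiv]
  simp [QuadraticMap.polar, ← hB, hB']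
  ring

/-- The covector `ξ = (2/i) ∂Φ/∂x (x)`. -/
def momentum (Φ : QuadraticForm ℝ (Fin n → ℂ)) (x : Fin n → ℂ) : Fin n → ℂ :=
  fun k => (2 / Complex.I) * dHol k (fun y => (Φ y : ℂ)) x

/-- The real linear subspace `Λ_Φ = {(x, (2/i) ∂Φ/∂x (x)) : x ∈ ℂⁿ}` of `ℂⁿ × ℂⁿ`. -/
def Lam (Φ : QuadraticForm ℝ (Fin n → ℂ)) : Submodule ℝ ((Fin n → ℂ) × (Fin n → ℂ)) where
  carrier := Set.range fun x => (x, momentum Φ x)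
  zero_mem' := ⟨0, by
    ext k <;> simp [momentum, dHol, fderiv_quadraticForm]⟩
  add_mem' := by
    rintro _ _ ⟨x, rfl⟩ ⟨y, rfl⟩
    refine ⟨x + y, ?_⟩
    ext k
    · rfl
    · simp only [momentum, dHol, fderiv_quadraticForm, QuadraticMap.polar_add_left, Prod.snd_add,
        Pi.add_apply]
      push_cast
      ring
  smul_mem' := by
    rintro c _ ⟨x, rfl⟩
    refine ⟨c • x, ?_⟩
    ext k
    · rfl
    · simp only [momentum, dHol, fderiv_quadraticForm, QuadraticMap.polar_smul_left, Prod.smul_snd,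
        Pi.smul_apply, smul_eq_mul, Complex.real_smul]
      push_cast
      ring

/-- The point `(x, (2/i) ∂Φ/∂x (x))` of `Λ_Φ` above `x`, i.e. the inverse of the projection
`π_x : Λ_Φ → ℂⁿ`. -/
def point (Φ : QuadraticForm ℝ (Fin n → ℂ)) (x : Fin n → ℂ) : Lam Φ :=
  ⟨(x, momentum Φ x), x, rfl⟩

/-- The complex symplectic form `σ = ∑ dξ_j ∧ dx_j` on `ℂⁿ_x × ℂⁿ_ξ`. -/
def sigma (X Y : (Fin n → ℂ) × (Fin n → ℂ)) : ℂ :=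
  ∑ j, (X.2 j * Y.1 j - Y.2 j * X.1 j)

/-- The identification `ℝ²ⁿ ≃ ℂⁿ`, `(p, q) ↦ p + i q`. -/
def ofReal2 (p : Fin n ⊕ Fin n → ℝ) : Fin n → ℂ :=
  fun j => (p (Sum.inl j) : ℂ) + Complex.I * (p (Sum.inr j) : ℂ)

/-- The Gram matrix of `σ|_Λ` in the real basis of `Λ_Φ` above the real basis
`e_1, …, e_n, i e_1, …, i e_n` of `ℂⁿ`. -/
def sigmaGram (Φ : QuadraticForm ℝ (Fin n → ℂ)) : Matrix (Fin n ⊕ Fin n) (Fin n ⊕ Fin n) ℂ :=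
  Matrix.of fun i j =>
    sigma (point Φ (ofReal2 (Pi.single i 1))).1 (point Φ (ofReal2 (Pi.single j 1))).1

/-- The measure `dX` on `Λ_Φ` given by the symplectic volume form `σⁿ/n!`. The value of
`σⁿ/n!` on a real basis is the Pfaffian of the Gram matrix of `σ` in that basis, so that in the
coordinate `x ∈ ℂⁿ` its density with respect to Lebesgue measure is `|det (Gram)|^{1/2}`. -/
def symplecticVolume (Φ : QuadraticForm ℝ (Fin n → ℂ)) : MeasureTheory.Measure (Lam Φ) :=
  ENNReal.ofReal (Real.sqrt ‖(sigmaGram Φ).det‖) •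
    (MeasureTheory.volume : MeasureTheory.Measure (Fin n → ℂ)).map (point Φ)

/-! ### Gevrey symbols on `Λ_Φ` -/

/-- The family `a(·; h)`, `0 < h ≤ 1`, belongs to `𝒢^s_b(Λ_Φ)`, with constants that do not depend on
`h`; here `Λ_Φ` is identified with `ℂⁿ ≃ ℝ²ⁿ` by the projection `(x, ξ) ↦ x`. -/
def IsGevreySymbol (Φ : QuadraticForm ℝ (Fin n → ℂ)) (s : ℝ) (a : ℝ → Lam Φ → ℂ) : Prop :=
  ∃ A > 0, ∃ C > 0, ∀ h ∈ Set.Ioc (0 : ℝ) 1,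
    GevreyBound s A C fun p : Fin n ⊕ Fin n → ℝ => a h (point Φ (ofReal2 p))

/-! ### Oscillatory integrals and the Weyl composition -/

/-- The oscillatory integral `∫ F dμ` exists and equals `L`: for every Schwartz function `χ` with
`χ(0) = 1`, the integrals `∫ χ(ε w) F(w) dμ(w)` tend to `L` as `ε → 0⁺`. -/
def HasOscillatoryIntegral {E : Type*} [NormedAddCommGroup E] [NormedSpace ℝ E]
    [MeasurableSpace E] (μ : MeasureTheory.Measure E) (F : E → ℂ) (L : ℂ) : Prop :=
  ∀ χ : SchwartzMap E ℂ, χ 0 = 1 →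
    Filter.Tendsto (fun ε : ℝ => ∫ w, χ (ε • w) * F w ∂μ) (𝓝[>] 0) (𝓝 L)

open Classical in
/-- The value of the oscillatory integral `∫ F dμ` (`0` if it does not exist). -/
def oscillatoryIntegral {E : Type*} [NormedAddCommGroup E] [NormedSpace ℝ E]
    [MeasurableSpace E] (μ : MeasureTheory.Measure E) (F : E → ℂ) : ℂ :=
  if H : ∃ L, HasOscillatoryIntegral μ F L then H.choose else 0

/-- `(Y, Z) ↦ e^{-2iσ(Y,Z)/h} a(X+Y) b(X+Z)` on `Λ_Φ × Λ_Φ`. -/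
def compIntegrand (Φ : QuadraticForm ℝ (Fin n → ℂ)) (h : ℝ) (a b : Lam Φ → ℂ) (X : Lam Φ) :
    Lam Φ × Lam Φ → ℂ :=
  fun W => Complex.exp (-2 * Complex.I * sigma W.1.1 W.2.1 / h) * a (X + W.1) * b (X + W.2)

/-- The Weyl composition
`(a # b)(X) = (πh)^{-2n} ∫∫_{Λ_Φ × Λ_Φ} e^{-2iσ(Y,Z)/h} a(X+Y) b(X+Z) dY dZ`. -/
def weylComp (Φ : QuadraticForm ℝ (Fin n → ℂ)) (h : ℝ) (a b : Lam Φ → ℂ) (X : Lam Φ) : ℂ :=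
  1 / ((Real.pi * h : ℝ) : ℂ) ^ (2 * n) *
    oscillatoryIntegral ((symplecticVolume Φ).prod (symplecticVolume Φ)) (compIntegrand Φ h a b X)

end GevreyWeyl

end

/-! The integral diverges absolutely, but its phase is a nondegenerate quadratic form in `w = (Y,
Z)`, so oscillation supplies the missing decay. Write the exponential as `ψ(w) = e^{-iB(w,w)/2}`.
Then `∂_v ψ = -i B(w,v) ψ`, hence `ψ = r (ψ - ∂_v ψ)` with `r = (1 + i B(w,v))⁻¹`, and integrating
by parts replaces `F` by `rF + ∂_v(rF)`. This gains a factor `|r|` at the cost of one derivative of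
`F`. Doing it twice in each direction of a basis gives the weight `∏ (1 + B(w,b_i)²)⁻¹`, which is
integrable because nondegeneracy makes the `B(·,b_i)` linear coordinates. The resulting absolutely
convergent integral is the limit for every cutoff, and it is bounded by finitely many derivatives of
the amplitude (`exists_hasOscillatoryIntegral`).

Nondegeneracy of `σ` on `Λ_Φ` is where plurisubharmonicity enters: `σ` paired on the points above
`x` and `ix` equals four times the Levi form at `x` (`sigmaLam_nondegenerate`).

Uniformity in `h` comes from the substitution `(Y, Z) = √h w`. The phase no longer contains `h`, the
Jacobian `h^{2n}` cancels the prefactor, and the amplitude becomes `a(X + √h Y) b(X + √h Z)`, whose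
derivatives in `w` are bounded uniformly since `√h ≤ 1` (`exists_composition`).

For the Gevrey estimate, the composition is a bilinear functional that obeys the Leibniz rule and is
controlled by a fixed number `N` of derivatives of each factor. A derivative of order `k` gives
`2^k` terms `J(∂^β a, ∂^γ b)`. The `N` extra derivatives cost only a geometric factor, since `(β+δ)!
≤ 2^{|β|+|δ|} β! δ!`, and `β! γ! ≤ (β+γ)!` recombines the factorials (`gevreyBound_of_bilinear`). -/

noncomputable section

namespace GevreyWeyl

/-! ### Directional derivatives and bounds on jets -/

section Jets

variable {W X : Type*} [NormedAddCommGroup W] [NormedSpace ℝ W]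
  [NormedAddCommGroup X] [NormedSpace ℝ X]

/-- The derivative of `F` in the direction `v`. -/
def dirDeriv (v : W) (F : W → ℂ) : W → ℂ := fun w => fderiv ℝ F w v

/-- All iterated derivatives of `F` at `w` of order at most `k` along vectors of the unit ball are
bounded by `M`. -/
def JetBound : ℕ → ℝ → (W → ℂ) → W → Prop
  | 0, M, F, w => ‖F w‖ ≤ M
  | k + 1, M, F, w => ‖F w‖ ≤ M ∧ ∀ v, ‖v‖ ≤ 1 → JetBound k M (dirDeriv v F) w

lemma contDiff_dirDeriv {F : W → ℂ} (hF : ContDiff ℝ ∞ F) (v : W) :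
    ContDiff ℝ ∞ (dirDeriv v F) :=
  (hF.fderiv_right (m := ∞) (by simp)).clm_apply contDiff_const

lemma differentiable_of_smooth {F : W → ℂ} (hF : ContDiff ℝ ∞ F) : Differentiable ℝ F :=
  hF.differentiable (by simp)

lemma dirDeriv_add {F G : W → ℂ} (hF : ContDiff ℝ ∞ F) (hG : ContDiff ℝ ∞ G) (v : W) :
    dirDeriv v (fun w => F w + G w) = fun w => dirDeriv v F w + dirDeriv v G w := by
  funext w
  simp [dirDeriv, fderiv_fun_add (differentiable_of_smooth hF w) (differentiable_of_smooth hG w)]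

lemma dirDeriv_sub {F G : W → ℂ} (hF : ContDiff ℝ ∞ F) (hG : ContDiff ℝ ∞ G) (v : W) :
    dirDeriv v (fun w => F w - G w) = fun w => dirDeriv v F w - dirDeriv v G w := by
  funext w
  simp [dirDeriv, fderiv_fun_sub (differentiable_of_smooth hF w) (differentiable_of_smooth hG w)]

lemma dirDeriv_const_mul {F : W → ℂ} (hF : ContDiff ℝ ∞ F) (c : ℂ) (v : W) :
    dirDeriv v (fun w => c * F w) = fun w => c * dirDeriv v F w := by
  funext w
  simp [dirDeriv, fderiv_const_mul (differentiable_of_smooth hF w)]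

lemma dirDeriv_mul {F G : W → ℂ} (hF : ContDiff ℝ ∞ F) (hG : ContDiff ℝ ∞ G) (v : W) :
    dirDeriv v (fun w => F w * G w) = fun w => dirDeriv v F w * G w + F w * dirDeriv v G w := by
  funext w
  simp [dirDeriv, fderiv_fun_mul (differentiable_of_smooth hF w) (differentiable_of_smooth hG w)]
  ring

lemma dirDeriv_comp_affine {F : X → ℂ} (hF : ContDiff ℝ ∞ F) (L : W →L[ℝ] X) (c : X) (v : W) :
    dirDeriv v (fun w => F (L w + c)) = fun w => dirDeriv (L v) F (L w + c) := by
  funext w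
  have h1 : HasFDerivAt (fun w => L w + c) L w := L.hasFDerivAt.add_const c
  have := ((differentiable_of_smooth hF (L w + c)).hasFDerivAt.comp w h1).fderiv
  simp only [dirDeriv]
  change fderiv ℝ (F ∘ fun w => L w + c) w v = _
  rw [this]
  simp

lemma dirDeriv_smul (c : ℝ) (v : W) (F : W → ℂ) :
    dirDeriv (c • v) F = fun w => (c : ℂ) * dirDeriv v F w := by
  funext w
  simp [dirDeriv]

lemma dirDeriv_sum {ι : Type*} (s : Finset ι) (v : ι → W) (F : W → ℂ) :
    dirDeriv (∑ i ∈ s, v i) F = fun w => ∑ i ∈ s, dirDeriv (v i) F w := by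
  funext w
  simp [dirDeriv]

lemma dirDeriv_comm {F : W → ℂ} (hF : ContDiff ℝ ∞ F) (u v : W) :
    dirDeriv u (dirDeriv v F) = dirDeriv v (dirDeriv u F) := by
  funext w
  have hd : DifferentiableAt ℝ (fderiv ℝ F) w :=
    (hF.fderiv_right (m := ∞) (by simp)).differentiable (by simp) w
  have key : ∀ a b : W, dirDeriv a (dirDeriv b F) w = fderiv ℝ (fderiv ℝ F) w a b := by
    intro a b
    have : HasFDerivAt (fun y => fderiv ℝ F y b) ((fderiv ℝ (fderiv ℝ F) w).flip b) w := by
      simpa using hd.hasFDerivAt.clm_apply (hasFDerivAt_const b w)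
    change fderiv ℝ (fun y => fderiv ℝ F y b) w a = _
    rw [this.fderiv]
    rfl
  rw [key, key]
  have h2 : minSmoothness ℝ 2 ≤ ∞ := by
    simpa using WithTop.coe_le_coe.2 (le_top : (2 : ℕ∞) ≤ ⊤)
  exact hF.contDiffAt.isSymmSndFDerivAt h2 u v

lemma JetBound.norm_le {k : ℕ} {M : ℝ} {F : W → ℂ} {w : W} (h : JetBound k M F w) :
    ‖F w‖ ≤ M := by
  cases k with
  | zero => exact h
  | succ k => exact h.1

lemma JetBound.nonneg {k : ℕ} {M : ℝ} {F : W → ℂ} {w : W} (h : JetBound k M F w) : 0 ≤ M :=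
  (norm_nonneg _).trans h.norm_le

lemma JetBound.mono {k : ℕ} {M M' : ℝ} {F : W → ℂ} {w : W} (h : JetBound k M F w)
    (hM : M ≤ M') : JetBound k M' F w := by
  induction k generalizing F with
  | zero => exact le_trans h hM
  | succ k ih => exact ⟨h.1.trans hM, fun v hv => ih (h.2 v hv)⟩

lemma JetBound.of_succ {k : ℕ} {M : ℝ} {F : W → ℂ} {w : W} (h : JetBound (k + 1) M F w) :
    JetBound k M F w := by
  induction k generalizing F with
  | zero => exact h.1
  | succ k ih => exact ⟨h.1, fun v hv => ih (h.2 v hv)⟩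

lemma JetBound.add {k : ℕ} {M M' : ℝ} {F G : W → ℂ} {w : W} (hF : ContDiff ℝ ∞ F)
    (hG : ContDiff ℝ ∞ G) (h : JetBound k M F w) (h' : JetBound k M' G w) :
    JetBound k (M + M') (fun w => F w + G w) w := by
  induction k generalizing F G with
  | zero => exact (norm_add_le _ _).trans (add_le_add h h')
  | succ k ih =>
    refine ⟨(norm_add_le _ _).trans (add_le_add h.1 h'.1), fun v hv => ?_⟩
    rw [dirDeriv_add hF hG]
    exact ih (contDiff_dirDeriv hF v) (contDiff_dirDeriv hG v) (h.2 v hv) (h'.2 v hv)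

lemma JetBound.const_mul {k : ℕ} {M : ℝ} {F : W → ℂ} {w : W} (hF : ContDiff ℝ ∞ F)
    (h : JetBound k M F w) (c : ℂ) : JetBound k (‖c‖ * M) (fun w => c * F w) w := by
  induction k generalizing F with
  | zero =>
    change ‖c * F w‖ ≤ _
    rw [norm_mul]
    exact mul_le_mul_of_nonneg_left h (norm_nonneg _)
  | succ k ih =>
    refine ⟨?_, fun v hv => ?_⟩
    · rw [norm_mul]
      exact mul_le_mul_of_nonneg_left h.1 (norm_nonneg _)
    rw [dirDeriv_const_mul hF]
    exact ih (contDiff_dirDeriv hF v) (h.2 v hv)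

lemma JetBound.sum {ι : Type*} (s : Finset ι) {k : ℕ} {M : ι → ℝ} {F : ι → W → ℂ} {w : W}
    (hF : ∀ i, ContDiff ℝ ∞ (F i)) (h : ∀ i ∈ s, JetBound k (M i) (F i) w) :
    JetBound k (∑ i ∈ s, M i) (fun w => ∑ i ∈ s, F i w) w := by
  classical
  induction s using Finset.induction_on with
  | empty =>
    have : ∀ k, JetBound k 0 (fun _ : W => (0 : ℂ)) w := by
      intro k
      induction k with
      | zero => simp [JetBound]
      | succ k ih =>
        refine ⟨by simp, fun v _ => ?_⟩
        have : dirDeriv v (fun _ : W => (0 : ℂ)) = fun _ => 0 := by funext; simp [dirDeriv]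
        rwa [this]
    simpa using this k
  | insert i s his ih =>
    simp only [Finset.sum_insert his]
    exact JetBound.add (hF i) (ContDiff.sum fun i _ => hF i) (h i (by simp))
      (ih fun j hj => h j (by simp [hj]))

/-- By the Leibniz rule each differentiation doubles the number of terms, whence `2 ^ k`. -/
lemma JetBound.mul {k : ℕ} {M M' : ℝ} {F G : W → ℂ} {w : W} (hF : ContDiff ℝ ∞ F)
    (hG : ContDiff ℝ ∞ G) (h : JetBound k M F w) (h' : JetBound k M' G w) :
    JetBound k (2 ^ k * (M * M')) (fun w => F w * G w) w := by
  induction k generalizing F G with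
  | zero =>
    change ‖F w * G w‖ ≤ _
    rw [norm_mul, pow_zero, one_mul]
    exact mul_le_mul h h' (norm_nonneg _) h.nonneg
  | succ k ih =>
    have hM := h.nonneg
    have hM' := h'.nonneg
    refine ⟨?_, fun v hv => ?_⟩
    · rw [norm_mul]
      refine (mul_le_mul h.1 h'.1 (norm_nonneg _) hM).trans ?_
      exact le_mul_of_one_le_left (by positivity) (one_le_pow₀ (by norm_num))
    rw [dirDeriv_mul hF hG]
    have := JetBound.add ((contDiff_dirDeriv hF v).mul hG) (hF.mul (contDiff_dirDeriv hG v))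
      (ih (contDiff_dirDeriv hF v) hG (h.2 v hv) h'.of_succ)
      (ih hF (contDiff_dirDeriv hG v) h.of_succ (h'.2 v hv))
    refine this.mono (le_of_eq ?_)
    ring

lemma JetBound.dirDeriv {k : ℕ} {M : ℝ} {F : W → ℂ} {w : W} (hF : ContDiff ℝ ∞ F)
    (h : JetBound (k + 1) M F w) (v : W) : JetBound k (‖v‖ * M) (dirDeriv v F) w := by
  have hv : v = ‖v‖ • (‖v‖⁻¹ • v) := by
    rcases eq_or_ne v 0 with rfl | hv
    · simp
    · rw [smul_smul, mul_inv_cancel₀ (norm_ne_zero_iff.2 hv), one_smul]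
  have hu : ‖‖v‖⁻¹ • v‖ ≤ 1 := by
    rw [norm_smul, norm_inv, norm_norm]
    exact inv_mul_le_one
  have := (h.2 _ hu).const_mul (contDiff_dirDeriv hF _) ((‖v‖ : ℝ) : ℂ)
  rw [← dirDeriv_smul, ← hv] at this
  simpa using this

lemma JetBound.comp_affine {k : ℕ} {M c : ℝ} {F : X → ℂ} {w : W} (hF : ContDiff ℝ ∞ F)
    (L : W →L[ℝ] X) (x : X) (hc : 1 ≤ c) (hL : ‖L‖ ≤ c) (h : JetBound k M F (L w + x)) :
    JetBound k (c ^ k * M) (fun w => F (L w + x)) w := by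
  induction k generalizing F M with
  | zero => simpa [JetBound] using h
  | succ k ih =>
    have hM := h.nonneg
    refine ⟨h.1.trans (le_mul_of_one_le_left hM (one_le_pow₀ hc)), fun v hv => ?_⟩
    rw [dirDeriv_comp_affine hF]
    have := ih (contDiff_dirDeriv hF (L v)) (h.dirDeriv hF (L v))
    refine this.mono ?_
    have hLv : ‖L v‖ ≤ c := by
      refine (L.le_of_opNorm_le hL v).trans ?_
      exact mul_le_of_le_one_right (by linarith) hv
    calc c ^ k * (‖L v‖ * M) ≤ c ^ k * (c * M) := by gcongr
      _ = c ^ (k + 1) * M := by ring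

lemma jetBound_of_iteratedFDeriv {k : ℕ} {M : ℝ} {F : W → ℂ} {w : W} (hF : ContDiff ℝ ∞ F)
    (h : ∀ i ≤ k, ‖iteratedFDeriv ℝ i F w‖ ≤ M) : JetBound k M F w := by
  have h0 : ‖F w‖ ≤ M := by simpa using h 0 (Nat.zero_le _)
  induction k generalizing F with
  | zero => exact h0
  | succ k ih =>
    have hd : ∀ v : W, ‖v‖ ≤ 1 → ∀ i ≤ k, ‖iteratedFDeriv ℝ i (GevreyWeyl.dirDeriv v F) w‖ ≤ M := by
      intro v hv i hi
      have h1 : ContDiffAt ℝ ∞ (fderiv ℝ F) w := (hF.fderiv_right (m := ∞) (by simp)).contDiffAt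
      have h2 := norm_iteratedFDeriv_clm_apply_const (c := v) (n := i) h1
        (by exact_mod_cast le_top)
      rw [norm_iteratedFDeriv_fderiv] at h2
      exact h2.trans ((mul_le_of_le_one_left (norm_nonneg _) hv).trans (h (i + 1) (by omega)))
    refine ⟨h0, fun v hv => ih (contDiff_dirDeriv hF v) (hd v hv) ?_⟩
    simpa using hd v hv 0 (Nat.zero_le _)

/-- Smooth functions all of whose derivatives are bounded. -/
def BddSmooth (F : W → ℂ) : Prop :=
  ContDiff ℝ ∞ F ∧ ∀ k, ∃ M, ∀ w, JetBound k M F w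

lemma BddSmooth.dirDeriv {F : W → ℂ} (hF : BddSmooth F) (v : W) :
    BddSmooth (dirDeriv v F) := by
  refine ⟨contDiff_dirDeriv hF.1 v, fun k => ?_⟩
  obtain ⟨M, hM⟩ := hF.2 (k + 1)
  exact ⟨_, fun w => (hM w).dirDeriv hF.1 v⟩

lemma BddSmooth.add {F G : W → ℂ} (hF : BddSmooth F) (hG : BddSmooth G) :
    BddSmooth (fun w => F w + G w) := by
  refine ⟨hF.1.add hG.1, fun k => ?_⟩
  obtain ⟨M, hM⟩ := hF.2 k
  obtain ⟨M', hM'⟩ := hG.2 k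
  exact ⟨_, fun w => (hM w).add hF.1 hG.1 (hM' w)⟩

lemma BddSmooth.const_mul {F : W → ℂ} (hF : BddSmooth F) (c : ℂ) :
    BddSmooth (fun w => c * F w) := by
  refine ⟨contDiff_const.mul hF.1, fun k => ?_⟩
  obtain ⟨M, hM⟩ := hF.2 k
  exact ⟨_, fun w => (hM w).const_mul hF.1 c⟩

lemma BddSmooth.sub {F G : W → ℂ} (hF : BddSmooth F) (hG : BddSmooth G) :
    BddSmooth (fun w => F w - G w) := by
  simpa [sub_eq_add_neg] using hF.add (hG.const_mul (-1))

lemma BddSmooth.mul {F G : W → ℂ} (hF : BddSmooth F) (hG : BddSmooth G) :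
    BddSmooth (fun w => F w * G w) := by
  refine ⟨hF.1.mul hG.1, fun k => ?_⟩
  obtain ⟨M, hM⟩ := hF.2 k
  obtain ⟨M', hM'⟩ := hG.2 k
  exact ⟨_, fun w => (hM w).mul hF.1 hG.1 (hM' w)⟩

lemma BddSmooth.comp_affine {F : X → ℂ} (hF : BddSmooth F) (L : W →L[ℝ] X) (x : X) :
    BddSmooth (fun w => F (L w + x)) := by
  refine ⟨hF.1.comp (L.contDiff.add contDiff_const), fun k => ?_⟩
  obtain ⟨M, hM⟩ := hF.2 k
  exact ⟨_, fun w => (hM _).comp_affine hF.1 L x (le_max_left 1 ‖L‖) (le_max_right _ _)⟩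

lemma BddSmooth.of_schwartz (χ : SchwartzMap W ℂ) : BddSmooth χ := by
  refine ⟨χ.smooth', fun k => ?_⟩
  choose C hC using fun i => χ.decay 0 i
  refine ⟨∑ i ∈ Finset.range (k + 1), C i, fun w =>
    jetBound_of_iteratedFDeriv χ.smooth' fun i hi => ?_⟩
  have h1 := (hC i).2 w
  rw [pow_zero, one_mul] at h1
  exact h1.trans (Finset.single_le_sum (f := C) (fun j _ => (hC j).1.le) (by simp; omega))

/-- Second order Taylor estimate for all the derivatives of `F`. -/
lemma jetBound_taylor {k : ℕ} {M : ℝ} {F : W → ℂ} (hF : ContDiff ℝ ∞ F)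
    (h : ∀ w, JetBound (k + 2) M F w) (v w : W) :
    JetBound k (M * ‖v‖ ^ 2) (fun w => F (w + v) - F w - dirDeriv v F w) w := by
  induction k generalizing F with
  | zero =>
    have hM := (h w).nonneg
    -- The bound on second derivatives makes `F'` Lipschitz with constant `M`; the mean value
    -- inequality on the ball of radius `‖v‖` about `w` then bounds the remainder.
    have h2 : ∀ z u : W, ‖dirDeriv u F z - dirDeriv u F w‖ ≤ M * ‖z - w‖ * ‖u‖ := by
      intro z u
      have hb : ∀ y : W, ‖fderiv ℝ (dirDeriv u F) y‖ ≤ ‖u‖ * M := by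
        intro y
        refine ContinuousLinearMap.opNorm_le_bound _ (by positivity) fun x => ?_
        have := (((h y).dirDeriv hF u).dirDeriv (contDiff_dirDeriv hF u) x).norm_le
        refine this.trans (le_of_eq ?_)
        ring
      have := convex_univ.norm_image_sub_le_of_norm_fderiv_le (𝕜 := ℝ) (f := dirDeriv u F)
        (fun y _ => differentiable_of_smooth (contDiff_dirDeriv hF u) y) (fun y _ => hb y)
        (Set.mem_univ w) (Set.mem_univ z)
      refine this.trans (le_of_eq ?_)
      ring
    have := (convex_closedBall w ‖v‖).norm_image_sub_le_of_norm_hasFDerivWithin_le'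
      (f := F) (f' := fderiv ℝ F) (φ := fderiv ℝ F w) (C := M * ‖v‖) (x := w) (y := w + v)
      (fun x _ => (differentiable_of_smooth hF x).hasFDerivAt.hasFDerivWithinAt)
      (fun x hx => by
        refine ContinuousLinearMap.opNorm_le_bound _ (by positivity) fun u => ?_
        refine (h2 x u).trans ?_
        rw [Metric.mem_closedBall, dist_eq_norm] at hx
        gcongr) (by simp) (by simp)
    simp only [add_sub_cancel_left] at this
    refine this.trans (le_of_eq ?_)
    ring
  | succ k ih =>
    -- Differentiation commutes with forming the Taylor remainder, so the induction hypothesis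
    -- applies to `∂_u F`.
    have ht : ContDiff ℝ ∞ (fun w => F (w + v)) := hF.comp (contDiff_id.add contDiff_const)
    refine ⟨(ih hF fun w => (h w).of_succ).norm_le, fun u hu => ?_⟩
    have e1 : dirDeriv u (fun w => F (w + v)) = fun w => dirDeriv u F (w + v) := by
      simpa using dirDeriv_comp_affine hF (ContinuousLinearMap.id ℝ W) v u
    rw [dirDeriv_sub (ht.sub hF) (contDiff_dirDeriv hF v), dirDeriv_sub ht hF, e1,
      dirDeriv_comm hF]
    exact ih (contDiff_dirDeriv hF u) fun w => (h w).2 u hu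

end Jets

/-! ### Integration by parts against a quadratic phase -/

section Phase

variable {W : Type*} [NormedAddCommGroup W] [NormedSpace ℝ W]

/-- `ψ` is an oscillating exponential `e^{-i B(w,w)/2}`. -/
structure IsPhase (ψ : W → ℂ) (B : W →L[ℝ] W →L[ℝ] ℝ) : Prop where
  smooth : ContDiff ℝ ∞ ψ
  norm_eq : ∀ w, ‖ψ w‖ = 1
  deriv : ∀ w v, fderiv ℝ ψ w v = -Complex.I * (B w v : ℂ) * ψ w

/-- The function `(1 + i ℓ)⁻¹` for a linear form `ℓ`. -/
def damp (ℓ : W →L[ℝ] ℝ) (w : W) : ℂ := (1 + Complex.I * (ℓ w : ℂ))⁻¹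

lemma one_add_I_mul_ne_zero (t : ℝ) : (1 + Complex.I * (t : ℂ)) ≠ 0 := by
  intro h
  have := congrArg Complex.re h
  simp at this

lemma norm_damp_sq (ℓ : W →L[ℝ] ℝ) (w : W) : ‖damp ℓ w‖ ^ 2 = (1 + ℓ w ^ 2)⁻¹ := by
  rw [damp, norm_inv, inv_pow, ← Complex.normSq_eq_norm_sq]
  congr 1
  simp [Complex.normSq_apply]
  ring

lemma norm_damp_le_one (ℓ : W →L[ℝ] ℝ) (w : W) : ‖damp ℓ w‖ ≤ 1 := by
  have h := norm_damp_sq ℓ w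
  have : (1 + ℓ w ^ 2)⁻¹ ≤ 1 := inv_le_one_of_one_le₀ (by nlinarith [sq_nonneg (ℓ w)])
  nlinarith [norm_nonneg (damp ℓ w)]

lemma contDiff_damp (ℓ : W →L[ℝ] ℝ) : ContDiff ℝ ∞ (damp ℓ) := by
  refine ContDiff.inv ?_ fun w => one_add_I_mul_ne_zero _
  exact contDiff_const.add (contDiff_const.mul (Complex.ofRealCLM.contDiff.comp ℓ.contDiff))

lemma dirDeriv_damp (ℓ : W →L[ℝ] ℝ) (v : W) :
    dirDeriv v (damp ℓ) = fun w => (-Complex.I * (ℓ v : ℂ)) * (damp ℓ w * damp ℓ w) := by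
  funext w
  have h1 : HasFDerivAt (fun w => 1 + Complex.I * (ℓ w : ℂ))
      (Complex.I • (Complex.ofRealCLM.comp ℓ)) w :=
    ((Complex.ofRealCLM.comp ℓ).hasFDerivAt.const_mul Complex.I).const_add 1
  have h2 := (hasDerivAt_inv (one_add_I_mul_ne_zero (ℓ w))).comp_hasFDerivAt w h1
  have h3 : dirDeriv v (damp ℓ) w = _ := congrArg (· v) h2.fderiv
  rw [h3]
  simp [damp]
  rw [← inv_pow]
  ring

/-- Since `∂_v r = -i ℓ(v) r²` and `|r| ≤ 1`, differentiating `r` never loses its decay. -/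
lemma exists_jetBound_damp (ℓ : W →L[ℝ] ℝ) (k : ℕ) :
    ∃ C, 0 ≤ C ∧ ∀ w, JetBound k (C * ‖damp ℓ w‖) (damp ℓ) w := by
  induction k with
  | zero => exact ⟨1, zero_le_one, fun w => by simp [JetBound]⟩
  | succ k ih =>
    obtain ⟨C, hC, h⟩ := ih
    refine ⟨1 + ‖ℓ‖ * (2 ^ k * (C * C)), by positivity, fun w => ⟨?_, fun v hv => ?_⟩⟩
    · exact le_mul_of_one_le_left (norm_nonneg _) (by
        have : 0 ≤ ‖ℓ‖ * (2 ^ k * (C * C)) := by positivity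
        linarith)
    · rw [dirDeriv_damp]
      have hs := contDiff_damp ℓ
      refine (((h w).mul hs hs (h w)).const_mul (hs.mul hs) _).mono ?_
      have h1 : ‖-Complex.I * (ℓ v : ℂ)‖ ≤ ‖ℓ‖ := by
        simpa using (ℓ.le_opNorm v).trans (mul_le_of_le_one_right (norm_nonneg _) hv)
      have h2 := norm_damp_le_one ℓ w
      have h3 := norm_nonneg (damp ℓ w)
      calc _ ≤ ‖ℓ‖ * (2 ^ k * (C * ‖damp ℓ w‖ * (C * 1))) := by gcongr
        _ = ‖ℓ‖ * (2 ^ k * (C * C)) * ‖damp ℓ w‖ := by ring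
        _ ≤ _ := by nlinarith

variable (B : W →L[ℝ] W →L[ℝ] ℝ)

/-- The result of integrating `F` by parts once in the direction `v` against the phase, see
`integral_byParts`. -/
def byParts (v : W) (F : W → ℂ) : W → ℂ :=
  fun w => damp (B.flip v) w * F w + dirDeriv v (fun w => damp (B.flip v) w * F w) w

/-- Repeated integration by parts in the directions `vs`. -/
def byPartsList (vs : List W) (F : W → ℂ) : W → ℂ := vs.foldl (fun F v => byParts B v F) F

/-- The decay gained by repeated integration by parts. -/
def dampList (vs : List W) (w : W) : ℝ := (vs.map fun v => ‖damp (B.flip v) w‖).prod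

lemma dampList_nonneg (vs : List W) (w : W) : 0 ≤ dampList B vs w :=
  List.prod_nonneg (by simp)

lemma contDiff_byParts (v : W) {F : W → ℂ} (hF : ContDiff ℝ ∞ F) :
    ContDiff ℝ ∞ (byParts B v F) :=
  have h := (contDiff_damp (B.flip v)).mul hF
  h.add (contDiff_dirDeriv h v)

lemma contDiff_byPartsList (vs : List W) {F : W → ℂ} (hF : ContDiff ℝ ∞ F) :
    ContDiff ℝ ∞ (byPartsList B vs F) := by
  induction vs generalizing F with
  | nil => exact hF
  | cons v vs ih => exact ih (contDiff_byParts B v hF)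

lemma byPartsList_sub (vs : List W) {F G : W → ℂ} (hF : ContDiff ℝ ∞ F) (hG : ContDiff ℝ ∞ G) :
    byPartsList B vs (fun w => F w - G w) =
      fun w => byPartsList B vs F w - byPartsList B vs G w := by
  induction vs generalizing F G with
  | nil => rfl
  | cons v vs ih =>
    have : byParts B v (fun w => F w - G w) = fun w => byParts B v F w - byParts B v G w := by
      funext w
      simp only [byParts, mul_sub]
      rw [dirDeriv_sub ((contDiff_damp _).mul hF) ((contDiff_damp _).mul hG)]
      ring
    change byPartsList B vs (byParts B v _) = _
    rw [this, ih (contDiff_byParts B v hF) (contDiff_byParts B v hG)]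
    rfl

lemma exists_jetBound_byParts (v : W) (k : ℕ) :
    ∃ K, 0 ≤ K ∧ ∀ (F : W → ℂ) (w : W) (M : ℝ), ContDiff ℝ ∞ F → JetBound (k + 1) M F w →
      JetBound k (K * (‖damp (B.flip v) w‖ * M)) (byParts B v F) w := by
  obtain ⟨C, hC, h⟩ := exists_jetBound_damp (B.flip v) (k + 1)
  refine ⟨(1 + ‖v‖) * (2 ^ (k + 1) * C), by positivity, fun F w M hF hM => ?_⟩
  have hs := contDiff_damp (B.flip v)
  have h1 := (h w).mul hs hF hM
  refine (h1.of_succ.add (hs.mul hF) (contDiff_dirDeriv (hs.mul hF) v)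
    (h1.dirDeriv (hs.mul hF) v)).mono (le_of_eq ?_)
  ring

/-- Each integration by parts uses up one derivative and gains one factor `|r|`. The constant is
independent of `F`, and the estimate is pointwise in `w`; both are needed to compare `χ(ε·)G` with
`G` under dominated convergence. -/
lemma exists_jetBound_byPartsList (vs : List W) (k : ℕ) :
    ∃ K, 0 ≤ K ∧ ∀ (F : W → ℂ) (w : W) (M : ℝ), ContDiff ℝ ∞ F →
      JetBound (k + vs.length) M F w →
      JetBound k (K * (dampList B vs w * M)) (byPartsList B vs F) w := by
  induction vs with
  | nil =>
    refine ⟨1, zero_le_one, fun F w M _ h => ?_⟩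
    simpa [dampList, byPartsList] using h
  | cons v vs ih =>
    obtain ⟨K, hK, h⟩ := ih
    obtain ⟨K', hK', h'⟩ := exists_jetBound_byParts B v (k + vs.length)
    refine ⟨K * K', by positivity, fun F w M hF hM => ?_⟩
    refine (h _ w _ (contDiff_byParts B v hF) (h' F w M hF hM)).mono (le_of_eq ?_)
    simp only [dampList, List.map_cons, List.prod_cons]
    ring

/-- Smooth functions all of whose derivatives are dominated by a fixed integrable power. -/
def RapidDecay (F : W → ℂ) : Prop :=
  ContDiff ℝ ∞ F ∧ ∀ k, ∃ C, ∀ w,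
    JetBound k (C * (1 + ‖w‖) ^ (-(Module.finrank ℝ W + 1 : ℕ) : ℝ)) F w

lemma RapidDecay.byParts {F : W → ℂ} (hF : RapidDecay F) (v : W) :
    RapidDecay (byParts B v F) := by
  refine ⟨contDiff_byParts B v hF.1, fun k => ?_⟩
  obtain ⟨C, hC⟩ := hF.2 (k + 1)
  obtain ⟨K, hK, h⟩ := exists_jetBound_byParts B v k
  refine ⟨K * C, fun w => (h F w _ hF.1 (hC w)).mono ?_⟩
  rw [mul_assoc]
  exact mul_le_mul_of_nonneg_left
    (mul_le_of_le_one_left (hC w).nonneg (norm_damp_le_one _ _)) hK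

lemma RapidDecay.mul {F G : W → ℂ} (hF : RapidDecay F) (hG : BddSmooth G) :
    RapidDecay (fun w => F w * G w) := by
  refine ⟨hF.1.mul hG.1, fun k => ?_⟩
  obtain ⟨C, hC⟩ := hF.2 k
  obtain ⟨M, hM⟩ := hG.2 k
  refine ⟨2 ^ k * (C * M), fun w => ((hC w).mul hF.1 hG.1 (hM w)).mono (le_of_eq ?_)⟩
  ring

lemma RapidDecay.of_schwartz (χ : SchwartzMap W ℂ) : RapidDecay χ := by
  refine ⟨χ.smooth', fun k => ?_⟩
  set N := Module.finrank ℝ W + 1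
  refine ⟨2 ^ N * ((Finset.Iic (N, k)).sup fun m => SchwartzMap.seminorm ℝ m.1 m.2) χ,
    fun w => jetBound_of_iteratedFDeriv χ.smooth' fun i hi => ?_⟩
  have h := SchwartzMap.one_add_le_sup_seminorm_apply (𝕜 := ℝ) (m := (N, k)) le_rfl hi χ w
  have hw : 0 < 1 + ‖w‖ := by positivity
  rw [Real.rpow_neg hw.le, Real.rpow_natCast, ← div_eq_mul_inv, le_div_iff₀ (by positivity),
    mul_comm]
  exact h

lemma RapidDecay.dirDeriv {F : W → ℂ} (hF : RapidDecay F) (v : W) :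
    RapidDecay (dirDeriv v F) := by
  refine ⟨contDiff_dirDeriv hF.1 v, fun k => ?_⟩
  obtain ⟨C, hC⟩ := hF.2 (k + 1)
  refine ⟨‖v‖ * C, fun w => ((hC w).dirDeriv hF.1 v).mono (le_of_eq ?_)⟩
  ring

lemma bddSmooth_damp (ℓ : W →L[ℝ] ℝ) : BddSmooth (damp ℓ) := by
  refine ⟨contDiff_damp ℓ, fun k => ?_⟩
  obtain ⟨C, hC, h⟩ := exists_jetBound_damp ℓ k
  exact ⟨C, fun w => (h w).mono (mul_le_of_le_one_right hC (norm_damp_le_one _ _))⟩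

variable [MeasurableSpace W] [BorelSpace W] (μ : MeasureTheory.Measure W)

lemma IsPhase.integrable_mul {B : W →L[ℝ] W →L[ℝ] ℝ} {ψ : W → ℂ} (hψ : IsPhase ψ B) {F : W → ℂ}
    (hF : MeasureTheory.Integrable F μ) : MeasureTheory.Integrable (fun w => ψ w * F w) μ :=
  hF.bdd_mul (c := 1) hψ.smooth.continuous.aestronglyMeasurable
    (Filter.Eventually.of_forall fun w => (hψ.norm_eq w).le)

variable [FiniteDimensional ℝ W] [μ.IsAddHaarMeasure]

lemma RapidDecay.integrable {F : W → ℂ} (hF : RapidDecay F) : MeasureTheory.Integrable F μ := by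
  obtain ⟨C, hC⟩ := hF.2 0
  have h : MeasureTheory.Integrable
      (fun w : W => (1 + ‖w‖) ^ (-(Module.finrank ℝ W + 1 : ℕ) : ℝ)) μ :=
    integrable_one_add_norm (by push_cast; linarith)
  exact (h.const_mul C).mono' hF.1.continuous.aestronglyMeasurable
    (Filter.Eventually.of_forall fun w => (hC w).norm_le)

variable {B} {ψ : W → ℂ}

/-- With `H = rF`, the identity `(1 + i B(w,v)) r = 1` gives `(∂_v ψ) H = ψH - ψF`. Moving the
derivative from `ψ` to `H` produces no boundary term, because `F` and its derivatives are
integrable. -/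
lemma integral_byParts (hψ : IsPhase ψ B) {F : W → ℂ} (hF : RapidDecay F) (v : W) :
    ∫ w, ψ w * byParts B v F w ∂μ = ∫ w, ψ w * F w ∂μ := by
  set r := damp (B.flip v)
  set H : W → ℂ := fun w => r w * F w with hH
  have hHr : RapidDecay H := by
    simpa [hH, mul_comm] using hF.mul (bddSmooth_damp (B.flip v))
  have e : ∀ w, fderiv ℝ ψ w v * H w = ψ w * H w - ψ w * F w := by
    intro w
    have h1 : (1 + Complex.I * (B w v : ℂ)) * r w = 1 :=
      mul_inv_cancel₀ (one_add_I_mul_ne_zero _)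
    rw [hψ.deriv, hH]
    linear_combination (-ψ w * F w) * h1
  have i1 := hψ.integrable_mul μ (hHr.integrable μ)
  have i2 := hψ.integrable_mul μ (hF.integrable μ)
  have i3 := hψ.integrable_mul μ ((hHr.dirDeriv v).integrable μ)
  have key := integral_mul_fderiv_eq_neg_fderiv_mul_of_integrable (μ := μ) (f := ψ) (g := H)
    (v := v) (by simp only [e]; exact i1.sub i2) i3 i1
    (fun x _ => differentiable_of_smooth hψ.smooth x)
    (fun x _ => differentiable_of_smooth hHr.1 x)
  simp only [e] at key
  rw [MeasureTheory.integral_sub i1 i2] at key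
  have : ∀ w, ψ w * byParts B v F w = ψ w * H w + ψ w * dirDeriv v H w := by
    intro w
    rw [← mul_add]
    rfl
  simp only [this]
  rw [MeasureTheory.integral_add i1 i3]
  simp only [dirDeriv]
  rw [key]
  ring

lemma integral_byPartsList (hψ : IsPhase ψ B) {F : W → ℂ} (hF : RapidDecay F) (vs : List W) :
    ∫ w, ψ w * byPartsList B vs F w ∂μ = ∫ w, ψ w * F w ∂μ := by
  induction vs generalizing F with
  | nil => rfl
  | cons v vs ih => exact (ih (hF.byParts B v)).trans (integral_byParts μ hψ hF v)

/-- The decay gained by integrating by parts twice in each direction of a basis is integrable if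
the phase is nondegenerate. -/
lemma exists_integrable_dampList (hB : ∀ w, (∀ v, B w v = 0) → w = 0) :
    ∃ vs : List W, MeasureTheory.Integrable (dampList B vs) μ := by
  let b := Module.finBasis ℝ W
  -- The forms `B(·, b_i)` serve as coordinates; nondegeneracy is exactly their joint injectivity.
  let L₀ : W →ₗ[ℝ] (Fin (Module.finrank ℝ W) → ℝ) :=
    LinearMap.pi fun i => (B.flip (b i)).toLinearMap
  have hL₀ : Function.Injective L₀ := by
    refine (injective_iff_map_eq_zero L₀).2 fun w hw => hB w fun v => ?_
    have h : (B w).toLinearMap = 0 := b.ext fun i => congrFun hw i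
    exact congrArg (fun l : W →ₗ[ℝ] ℝ => l v) h
  let L : W ≃L[ℝ] (Fin (Module.finrank ℝ W) → ℝ) :=
    (LinearEquiv.ofInjectiveOfFinrankEq L₀ hL₀ (by simp)).toContinuousLinearEquiv
  have hL : ∀ w i, L w i = B w (b i) := fun w i => rfl
  have hμ : (μ.map L).IsAddHaarMeasure := L.isAddHaarMeasure_map μ
  have hint : MeasureTheory.Integrable
      (fun x : Fin (Module.finrank ℝ W) → ℝ => ∏ i, (1 + x i ^ 2)⁻¹) (μ.map L) := by
    rw [MeasureTheory.Measure.isAddLeftInvariant_eq_smul (μ.map L)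
      (MeasureTheory.volume : MeasureTheory.Measure (Fin (Module.finrank ℝ W) → ℝ))]
    refine MeasureTheory.Integrable.smul_measure_nnreal ?_
    exact MeasureTheory.Integrable.fintype_prod fun _ => integrable_inv_one_add_sq
  have hint' := (L.toHomeomorph.measurableEmbedding.integrable_map_iff).1 hint
  -- Every direction occurs twice: `|r|² = (1 + t²)⁻¹` is integrable on the line, whereas `|r|`
  -- alone is not.
  let l := List.ofFn b
  refine ⟨l ++ l, hint'.congr (Filter.Eventually.of_forall fun w => ?_)⟩
  simp only [dampList, List.map_append, List.prod_append, l, List.map_ofFn, List.prod_ofFn,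
    ← Finset.prod_mul_distrib, Function.comp_apply]
  refine Finset.prod_congr rfl fun i _ => ?_
  rw [← pow_two, norm_damp_sq]
  rfl

end Phase

/-! ### Oscillatory integrals with quadratic phase -/

section Osc

variable {W X : Type*} [NormedAddCommGroup W] [NormedSpace ℝ W]
  [NormedAddCommGroup X] [NormedSpace ℝ X]

/-- The Schwartz function `w ↦ χ(ε w)`. -/
def dilate (χ : SchwartzMap W ℂ) (ε : ℝ) (hε : ε ≠ 0) : SchwartzMap W ℂ :=
  SchwartzMap.compCLMOfContinuousLinearEquiv ℝ
    (ContinuousLinearEquiv.smulLeft (M₁ := W) (Units.mk0 ε hε)) χ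

lemma jetBound_dilate {χ : W → ℂ} (hχ : ContDiff ℝ ∞ χ) {k : ℕ} {M : ℝ}
    (h : ∀ w, JetBound k M χ w) {ε : ℝ} (hε : |ε| ≤ 1) (w : W) :
    JetBound k M (fun w => χ (ε • w)) w := by
  have hn : ‖ε • ContinuousLinearMap.id ℝ W‖ ≤ 1 :=
    ContinuousLinearMap.opNorm_le_bound _ zero_le_one fun x => by
      simpa [norm_smul] using mul_le_mul_of_nonneg_right hε (norm_nonneg x)
  simpa using JetBound.comp_affine (w := w) hχ (ε • ContinuousLinearMap.id ℝ W) 0 le_rfl hn (h _)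

/-- Every derivative of positive order carries a factor `ε`, so only the value `χ(εw) - 1` itself
needs a separate term. Both terms vanish as `ε → 0` for fixed `w` when `χ(0) = 1`. -/
lemma jetBound_dilate_sub_one {χ : W → ℂ} (hχ : ContDiff ℝ ∞ χ) {k : ℕ} {M : ℝ}
    (h : ∀ w, JetBound k M χ w) {ε : ℝ} (hε : |ε| ≤ 1) (w : W) :
    JetBound k (‖χ (ε • w) - 1‖ + |ε| * M) (fun w => χ (ε • w) - 1) w := by
  have hM := (h 0).nonneg
  have h0 : ‖χ (ε • w) - 1‖ ≤ ‖χ (ε • w) - 1‖ + |ε| * M := by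
    have : 0 ≤ |ε| * M := by positivity
    linarith
  cases k with
  | zero => exact h0
  | succ k =>
    refine ⟨h0, fun v hv => ?_⟩
    have e : dirDeriv v (fun w => χ (ε • w) - 1) = fun w => (ε : ℂ) * dirDeriv v χ (ε • w) := by
      have e1 := dirDeriv_comp_affine hχ (ε • ContinuousLinearMap.id ℝ W) 0 v
      simp only [smul_apply, ContinuousLinearMap.id_apply, add_zero,
        dirDeriv_smul] at e1
      rw [← e1]
      funext w
      rw [dirDeriv, dirDeriv, fderiv_sub_const]
    rw [e]
    have hd := contDiff_dirDeriv hχ v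
    have := (jetBound_dilate hd (fun w => (h w).2 v hv) hε w).const_mul
      (hd.comp (contDiff_const_smul ε)) (ε : ℂ)
    refine this.mono ?_
    rw [Complex.norm_real, Real.norm_eq_abs]
    linarith [norm_nonneg (χ (ε • w) - 1)]

lemma RapidDecay.dilate_mul (χ : SchwartzMap W ℂ) {ε : ℝ} (hε : ε ≠ 0) {G : W → ℂ}
    (hG : BddSmooth G) : RapidDecay (fun w => χ (ε • w) * G w) :=
  (RapidDecay.of_schwartz (dilate χ ε hε)).mul hG

variable [FiniteDimensional ℝ W]

/-- Without such a cutoff the defining condition of an oscillatory integral would be vacuous and its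
value undetermined. -/
lemma exists_schwartz_eq_one : ∃ χ : SchwartzMap W ℂ, χ 0 = 1 := by
  let f : ContDiffBump (0 : W) := ⟨1, 2, one_pos, one_lt_two⟩
  have hc : HasCompactSupport (fun w => (f w : ℂ)) :=
    f.hasCompactSupport.comp_left (g := fun x : ℝ => (x : ℂ)) (by simp)
  refine ⟨hc.toSchwartzMap (Complex.ofRealCLM.contDiff.comp f.contDiff), ?_⟩
  change ((f 0 : ℝ) : ℂ) = 1
  rw [f.one_of_mem_closedBall (by simp [f.rIn_pos.le])]
  simp

variable [MeasurableSpace W]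

lemma HasOscillatoryIntegral.unique {μ : MeasureTheory.Measure W} {F : W → ℂ} {L L' : ℂ}
    (h : HasOscillatoryIntegral μ F L) (h' : HasOscillatoryIntegral μ F L') : L = L' := by
  obtain ⟨χ, hχ⟩ := exists_schwartz_eq_one (W := W)
  exact tendsto_nhds_unique (h χ hχ) (h' χ hχ)

lemma HasOscillatoryIntegral.eq {μ : MeasureTheory.Measure W} {F : W → ℂ} {L : ℂ}
    (h : HasOscillatoryIntegral μ F L) : oscillatoryIntegral μ F = L := by
  have H : ∃ L, HasOscillatoryIntegral μ F L := ⟨L, h⟩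
  rw [oscillatoryIntegral, dif_pos H]
  exact H.choose_spec.unique h

variable [BorelSpace W] (μ : MeasureTheory.Measure W) [μ.IsAddHaarMeasure]
  {B : W →L[ℝ] W →L[ℝ] ℝ} {ψ : W → ℂ}

/-- Rescaling of the variable in an oscillatory integral. -/
lemma HasOscillatoryIntegral.of_comp_smul {F : W → ℂ} {L : ℂ} {c : ℝ} (hc : 0 < c)
    (h : HasOscillatoryIntegral μ (fun w => F (c • w)) L) :
    HasOscillatoryIntegral μ F ((c : ℂ) ^ Module.finrank ℝ W * L) := by
  intro χ hχ
  have h1 : Filter.Tendsto (fun ε : ℝ => ε * c) (𝓝[>] 0) (𝓝[>] 0) := by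
    refine tendsto_nhdsWithin_iff.2 ⟨?_, ?_⟩
    · exact ((continuous_mul_const c).tendsto' 0 0 (zero_mul c)).mono_left nhdsWithin_le_nhds
    · filter_upwards [self_mem_nhdsWithin] with ε hε
      exact mul_pos hε hc
  have h2 := ((h χ hχ).comp h1).const_mul ((c : ℂ) ^ Module.finrank ℝ W)
  refine h2.congr fun ε => ?_
  have := MeasureTheory.Measure.integral_comp_smul μ (fun w => χ (ε • w) * F w) c
  simp only [Function.comp_apply, mul_smul]
  rw [this, abs_of_pos (by positivity), Complex.real_smul]
  push_cast
  rw [← mul_assoc, mul_inv_cancel₀ (pow_ne_zero _ (by exact_mod_cast hc.ne')), one_mul]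

/-- The combination of `G₁` and `G₂` may be integrated termwise. -/
lemma HasOscillatoryIntegral.add_const_mul (hψ : IsPhase ψ B) {G₁ G₂ : W → ℂ}
    (h₁ : BddSmooth G₁) (h₂ : BddSmooth G₂) {L₁ L₂ : ℂ} (c : ℂ)
    (H₁ : HasOscillatoryIntegral μ (fun w => ψ w * G₁ w) L₁)
    (H₂ : HasOscillatoryIntegral μ (fun w => ψ w * G₂ w) L₂) :
    HasOscillatoryIntegral μ (fun w => ψ w * (G₁ w + c * G₂ w)) (L₁ + c * L₂) := by
  intro χ hχ
  refine ((H₁ χ hχ).add ((H₂ χ hχ).const_mul c)).congr' ?_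
  filter_upwards [self_mem_nhdsWithin] with ε hε
  have i : ∀ {G : W → ℂ}, BddSmooth G →
      MeasureTheory.Integrable (fun w => χ (ε • w) * (ψ w * G w)) μ := fun {G} hG =>
    (hψ.integrable_mul μ ((RapidDecay.dilate_mul χ (ne_of_gt hε) hG).integrable μ)).congr
      (Filter.Eventually.of_forall fun w => by ring)
  rw [← MeasureTheory.integral_const_mul, ← MeasureTheory.integral_add (i h₁) ((i h₂).const_mul c)]
  refine MeasureTheory.integral_congr_ae (Filter.Eventually.of_forall fun w => ?_)
  change _ = χ (ε • w) * (ψ w * (G₁ w + c * G₂ w))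
  ring

/-- Existence of the oscillatory integral of a function with bounded derivatives against a
nondegenerate quadratic phase, and its continuity with respect to finitely many derivatives. -/
theorem exists_hasOscillatoryIntegral (hψ : IsPhase ψ B) (hB : ∀ w, (∀ v, B w v = 0) → w = 0) :
    ∃ (N : ℕ) (K : ℝ), 0 ≤ K ∧ ∀ G : W → ℂ, BddSmooth G → ∃ L : ℂ,
      HasOscillatoryIntegral μ (fun w => ψ w * G w) L ∧
        ∀ M, (∀ w, JetBound N M G w) → ‖L‖ ≤ K * M := by
  obtain ⟨vs, hvs⟩ := exists_integrable_dampList (B := B) μ hB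
  obtain ⟨K, hK, hKb⟩ := exists_jetBound_byPartsList B vs 0
  simp only [Nat.zero_add] at hKb
  refine ⟨vs.length, K * ∫ w, dampList B vs w ∂μ,
    mul_nonneg hK (MeasureTheory.integral_nonneg fun w => dampList_nonneg B vs w), ?_⟩
  intro G hG
  -- The value is the integral after all integrations by parts, which converges absolutely and does
  -- not involve the cutoff.
  refine ⟨∫ w, ψ w * byPartsList B vs G w ∂μ, ?_, ?_⟩
  swap
  · intro M hM
    refine (MeasureTheory.norm_integral_le_of_norm_le
      ((hvs.const_mul (K * M))) (Filter.Eventually.of_forall fun w => ?_)).trans (le_of_eq ?_)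
    · rw [norm_mul, hψ.norm_eq, one_mul]
      refine (hKb G w M hG.1 (hM w)).norm_le.trans (le_of_eq ?_)
      ring
    · rw [MeasureTheory.integral_const_mul]
      ring
  intro χ hχ
  obtain ⟨M, hM⟩ := hG.2 vs.length
  obtain ⟨M', hM'⟩ := (BddSmooth.of_schwartz χ).2 vs.length
  have hs : ∀ ε : ℝ, ContDiff ℝ ∞ (fun w => χ (ε • w)) := fun ε =>
    χ.smooth'.comp (contDiff_const_smul ε)
  have hε1 : ∀ᶠ ε : ℝ in 𝓝[>] 0, 0 < ε ∧ |ε| ≤ 1 := by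
    filter_upwards [Ioc_mem_nhdsGT (zero_lt_one (α := ℝ))] with ε hε
    exact ⟨hε.1, by rw [abs_of_pos hε.1]; exact hε.2⟩
  have hlim : Filter.Tendsto
      (fun ε : ℝ => ∫ w, ψ w * byPartsList B vs (fun w => χ (ε • w) * G w) w ∂μ) (𝓝[>] 0)
      (𝓝 (∫ w, ψ w * byPartsList B vs G w ∂μ)) := by
    refine MeasureTheory.tendsto_integral_filter_of_dominated_convergence
      (fun w => K * (2 ^ vs.length * (M' * M)) * dampList B vs w) ?_ ?_ (hvs.const_mul _) ?_
    · exact Filter.Eventually.of_forall fun ε => (hψ.smooth.continuous.mul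
        (contDiff_byPartsList B vs ((hs ε).mul hG.1)).continuous).aestronglyMeasurable
    · filter_upwards [hε1] with ε hε
      refine Filter.Eventually.of_forall fun w => ?_
      rw [norm_mul, hψ.norm_eq, one_mul]
      refine (hKb _ w _ ((hs ε).mul hG.1) ((jetBound_dilate χ.smooth' hM' hε.2 w).mul (hs ε)
        hG.1 (hM w))).norm_le.trans (le_of_eq ?_)
      ring
    -- Pointwise convergence: the difference of the two integrands is the integrated-by-parts form
    -- of `(χ(ε·) - 1) G`, whose jet at `w` tends to zero.
    · refine Filter.Eventually.of_forall fun w => ?_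
      refine Filter.Tendsto.const_mul _ ?_
      rw [tendsto_iff_norm_sub_tendsto_zero]
      have hχc : Filter.Tendsto (fun ε : ℝ => ‖χ (ε • w) - 1‖ + |ε| * M') (𝓝[>] 0) (𝓝 0) := by
        have hc : Continuous (fun ε : ℝ => ‖χ (ε • w) - 1‖ + |ε| * M') := by
          have := χ.continuous
          fun_prop
        have := hc.tendsto 0
        simp only [zero_smul, hχ, sub_self, norm_zero, abs_zero, zero_mul, add_zero] at this
        exact this.mono_left nhdsWithin_le_nhds
      have hb := (((hχc.mul_const M).const_mul (2 ^ vs.length)).const_mul (dampList B vs w)).const_mul K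
      simp only [zero_mul, mul_zero] at hb
      refine squeeze_zero' (Filter.Eventually.of_forall fun _ => norm_nonneg _) ?_ hb
      filter_upwards [hε1] with ε hε
      have h1 : ContDiff ℝ ∞ (fun w => χ (ε • w) - 1) := (hs ε).sub contDiff_const
      have h2 := hKb _ w _ (h1.mul hG.1)
        ((jetBound_dilate_sub_one χ.smooth' hM' hε.2 w).mul h1 hG.1 (hM w))
      have e : (fun w => (χ (ε • w) - 1) * G w) = fun w => χ (ε • w) * G w - G w := by
        funext w
        ring
      rw [e, byPartsList_sub B vs ((hs ε).mul hG.1) hG.1] at h2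
      exact h2
  -- For `ε > 0` the cutoff amplitude decays rapidly, so the integrations by parts can be undone.
  refine hlim.congr' ?_
  filter_upwards [hε1] with ε hε
  rw [integral_byPartsList μ hψ (RapidDecay.dilate_mul χ hε.1.ne' hG)]
  refine MeasureTheory.integral_congr_ae (Filter.Eventually.of_forall fun w => ?_)
  change ψ w * (χ (ε • w) * G w) = χ (ε • w) * (ψ w * G w)
  ring

/-! ### Oscillatory integrals with parameters -/

/-- The oscillatory integral `∫ ψ(w) Γ(A w + y) dμ(w)`. -/
def oscParam (ψ : W → ℂ) (A : W →L[ℝ] X) (Γ : X → ℂ) (y : X) : ℂ :=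
  oscillatoryIntegral μ (fun w => ψ w * Γ (A w + y))

/-- `N` and `K` depend on `A` only through the bound `c` on its norm. This is what later allows `A`
to carry the factor `√h` with constants independent of `h`. -/
theorem exists_oscParam_bound (hψ : IsPhase ψ B) (hB : ∀ w, (∀ v, B w v = 0) → w = 0) {c : ℝ}
    (hc : 1 ≤ c) :
    ∃ (N : ℕ) (K : ℝ), 0 ≤ K ∧ ∀ A : W →L[ℝ] X, ‖A‖ ≤ c → ∀ Γ : X → ℂ, BddSmooth Γ → ∀ y,
      HasOscillatoryIntegral μ (fun w => ψ w * Γ (A w + y)) (oscParam μ ψ A Γ y) ∧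
        ∀ M, (∀ x, JetBound N M Γ x) → ‖oscParam μ ψ A Γ y‖ ≤ K * M := by
  obtain ⟨N, K, hK, h⟩ := exists_hasOscillatoryIntegral μ hψ hB
  refine ⟨N, K * c ^ N, by positivity, fun A hA Γ hΓ y => ?_⟩
  obtain ⟨L, hL, hb⟩ := h _ (hΓ.comp_affine A y)
  have e : oscParam μ ψ A Γ y = L := hL.eq
  rw [e]
  refine ⟨hL, fun M hM => (hb _ fun w => (hM _).comp_affine hΓ.1 A y hc hA).trans (le_of_eq ?_)⟩
  ring

section

variable (hψ : IsPhase ψ B) (hB : ∀ w, (∀ v, B w v = 0) → w = 0) (A : W →L[ℝ] X)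
include hψ hB

lemma oscParam_add_const_mul {Γ₁ Γ₂ : X → ℂ} (h₁ : BddSmooth Γ₁) (h₂ : BddSmooth Γ₂) (c : ℂ)
    (y : X) : oscParam μ ψ A (fun x => Γ₁ x + c * Γ₂ x) y =
      oscParam μ ψ A Γ₁ y + c * oscParam μ ψ A Γ₂ y := by
  obtain ⟨N, K, hK, h⟩ := exists_oscParam_bound (X := X) μ hψ hB (le_max_left 1 ‖A‖)
  have h := h A (le_max_right _ _)
  exact (HasOscillatoryIntegral.add_const_mul μ hψ (h₁.comp_affine A y) (h₂.comp_affine A y) c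
    (h _ h₁ y).1 (h _ h₂ y).1).eq

lemma oscParam_add {Γ₁ Γ₂ : X → ℂ} (h₁ : BddSmooth Γ₁) (h₂ : BddSmooth Γ₂) (y : X) :
    oscParam μ ψ A (fun x => Γ₁ x + Γ₂ x) y = oscParam μ ψ A Γ₁ y + oscParam μ ψ A Γ₂ y := by
  simpa using oscParam_add_const_mul μ hψ hB A h₁ h₂ 1 y

lemma oscParam_sub {Γ₁ Γ₂ : X → ℂ} (h₁ : BddSmooth Γ₁) (h₂ : BddSmooth Γ₂) (y : X) :
    oscParam μ ψ A (fun x => Γ₁ x - Γ₂ x) y = oscParam μ ψ A Γ₁ y - oscParam μ ψ A Γ₂ y := by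
  simpa [← sub_eq_add_neg] using oscParam_add_const_mul μ hψ hB A h₁ h₂ (-1) y

lemma oscParam_const_mul {Γ : X → ℂ} (h : BddSmooth Γ) (c : ℂ) (y : X) :
    oscParam μ ψ A (fun x => c * Γ x) y = c * oscParam μ ψ A Γ y := by
  -- Homogeneity follows from the rule for `Γ₁ + c Γ₂` with `Γ₁ = Γ - Γ`.
  have h0 := oscParam_sub μ hψ hB A h h y
  simp only [sub_self] at h0
  have := oscParam_add_const_mul μ hψ hB A (h.sub h) h c y
  simpa [h0] using this

variable [FiniteDimensional ℝ X]

/-- Differentiation under the oscillatory integral. -/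
lemma hasFDerivAt_oscParam {Γ : X → ℂ} (hΓ : BddSmooth Γ) (y : X) :
    ∃ D : X →L[ℝ] ℂ, HasFDerivAt (oscParam μ ψ A Γ) D y ∧
      ∀ v, D v = oscParam μ ψ A (dirDeriv v Γ) y := by
  let D : X →ₗ[ℝ] ℂ :=
    { toFun := fun v => oscParam μ ψ A (dirDeriv v Γ) y
      map_add' := fun u v => by
        rw [← oscParam_add μ hψ hB A (hΓ.dirDeriv u) (hΓ.dirDeriv v)]
        congr 1
        funext x
        simp [dirDeriv]
      map_smul' := fun c v => by
        rw [dirDeriv_smul, oscParam_const_mul μ hψ hB A (hΓ.dirDeriv v)]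
        simp }
  refine ⟨LinearMap.toContinuousLinearMap D, ?_, fun v => rfl⟩
  obtain ⟨N, K, hK, h⟩ := exists_oscParam_bound (X := X) μ hψ hB (le_max_left 1 ‖A‖)
  have h := h A (le_max_right _ _)
  obtain ⟨M, hM⟩ := hΓ.2 (N + 2)
  -- The increment minus its linear part is the oscillatory integral of the Taylor remainder of `Γ`,
  -- whose jets of order `N` are at most `M ‖v‖²`.
  have key : ∀ v : X, ‖oscParam μ ψ A Γ (y + v) - oscParam μ ψ A Γ y - D v‖ ≤
      K * M * ‖v‖ ^ 2 := by
    intro v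
    have ht : BddSmooth (fun x => Γ (x + v)) := by
      simpa using hΓ.comp_affine (ContinuousLinearMap.id ℝ X) v
    have e1 : oscParam μ ψ A Γ (y + v) = oscParam μ ψ A (fun x => Γ (x + v)) y := by
      simp only [oscParam, add_assoc]
    have e2 : D v = oscParam μ ψ A (dirDeriv v Γ) y := rfl
    rw [e1, e2, ← oscParam_sub μ hψ hB A ht hΓ,
      ← oscParam_sub μ hψ hB A (ht.sub hΓ) (hΓ.dirDeriv v)]
    refine ((h _ ((ht.sub hΓ).sub (hΓ.dirDeriv v)) y).2 _
      fun x => jetBound_taylor hΓ.1 hM v x).trans (le_of_eq ?_)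
    ring
  rw [hasFDerivAt_iff_isLittleO_nhds_zero]
  refine Asymptotics.IsBigO.trans_isLittleO (g := fun v : X => ‖v‖ ^ 2) ?_ ?_
  · refine Asymptotics.IsBigO.of_bound (K * M) (Filter.Eventually.of_forall fun v => ?_)
    simpa using key v
  · exact Asymptotics.isLittleO_norm_pow_id one_lt_two

lemma dirDeriv_oscParam {Γ : X → ℂ} (hΓ : BddSmooth Γ) (v : X) :
    dirDeriv v (oscParam μ ψ A Γ) = oscParam μ ψ A (dirDeriv v Γ) := by
  funext y
  obtain ⟨D, hD, hDv⟩ := hasFDerivAt_oscParam μ hψ hB A hΓ y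
  rw [dirDeriv, hD.fderiv, hDv]

lemma contDiff_oscParam {Γ : X → ℂ} (hΓ : BddSmooth Γ) :
    ContDiff ℝ ∞ (oscParam μ ψ A Γ) := by
  rw [contDiff_infty]
  intro n
  have hd : ∀ {Γ : X → ℂ}, BddSmooth Γ → Differentiable ℝ (oscParam μ ψ A Γ) := fun hΓ y =>
    (hasFDerivAt_oscParam μ hψ hB A hΓ y).choose_spec.1.differentiableAt
  induction n generalizing Γ with
  | zero => exact contDiff_zero.2 (hd hΓ).continuous
  | succ n ih =>
    push_cast
    -- Each directional derivative is again an oscillatory integral with a bounded smooth amplitude,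
    -- so the induction closes.
    refine contDiff_succ_iff_fderiv_apply.2 ⟨hd hΓ, by simp, fun v => ?_⟩
    have := ih (hΓ.dirDeriv v)
    rwa [← dirDeriv_oscParam μ hψ hB A hΓ v] at this

end

end Osc

/-! ### Gevrey estimates for bilinear functionals -/

section Gevrey

variable {ι : Type*} [Fintype ι]

/-- The factorial `α!` of a multi-index. -/
def multiFactorial (α : ι → ℕ) : ℕ := ∏ i, (α i).factorial

lemma multiFactorial_mul_le (α β : ι → ℕ) :
    multiFactorial α * multiFactorial β ≤ multiFactorial (α + β) := by
  rw [multiFactorial, multiFactorial, multiFactorial, ← Finset.prod_mul_distrib]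
  exact Finset.prod_le_prod' fun i _ =>
    Nat.le_of_dvd (Nat.factorial_pos _) (Nat.factorial_mul_factorial_dvd_factorial_add _ _)

lemma multiFactorial_add_le (α β : ι → ℕ) :
    multiFactorial (α + β) ≤
      2 ^ (∑ i, α i + ∑ i, β i) * (multiFactorial α * multiFactorial β) := by
  rw [multiFactorial, multiFactorial, multiFactorial, ← Finset.prod_mul_distrib,
    ← Finset.sum_add_distrib, ← Finset.prod_pow_eq_pow_sum, ← Finset.prod_mul_distrib]
  refine Finset.prod_le_prod' fun i _ => ?_
  rw [Pi.add_apply, ← Nat.add_choose_mul_factorial_mul_factorial, mul_assoc]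
  exact Nat.mul_le_mul_right _ (Nat.choose_le_two_pow _ _)

lemma multiFactorial_le (α : ι → ℕ) : multiFactorial α ≤ (∑ i, α i).factorial :=
  Nat.le_of_dvd (Nat.factorial_pos _) (Nat.prod_factorial_dvd_factorial_sum _ _)

variable [DecidableEq ι]

/-- The multi-index `α i = #{l | j_l = i}` of a list of coordinate indices. -/
def multiIndex (js : List ι) : ι → ℕ := fun i => js.count i

lemma sum_multiIndex (js : List ι) : ∑ i, multiIndex js i = js.length := by
  simpa [multiIndex] using Multiset.sum_count_eq_card (s := Finset.univ) (m := (js : Multiset ι))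
    (by simp)

omit [Fintype ι] in
lemma multiIndex_cons (i : ι) (js : List ι) :
    multiIndex (i :: js) = Pi.single i 1 + multiIndex js := by
  funext l
  by_cases h : i = l
  · simp [multiIndex, h, add_comm]
  · simp [multiIndex, h]

/-- The iterated partial derivative `∂_{j₁} ⋯ ∂_{j_k} f`. -/
def partialDeriv (js : List ι) (f : (ι → ℝ) → ℂ) : (ι → ℝ) → ℂ :=
  js.foldl (fun f i => dirDeriv (Pi.single i (1 : ℝ)) f) f

lemma partialDeriv_cons (i : ι) (js : List ι) (f : (ι → ℝ) → ℂ) :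
    partialDeriv (i :: js) f = partialDeriv js (dirDeriv (Pi.single i (1 : ℝ)) f) := rfl

lemma partialDeriv_add (js : List ι) {f g : (ι → ℝ) → ℂ} (hf : ContDiff ℝ ∞ f)
    (hg : ContDiff ℝ ∞ g) : partialDeriv js (fun x => f x + g x) =
      fun x => partialDeriv js f x + partialDeriv js g x := by
  induction js generalizing f g with
  | nil => rfl
  | cons i js ih =>
    rw [partialDeriv_cons, dirDeriv_add hf hg, ih (contDiff_dirDeriv hf _) (contDiff_dirDeriv hg _)]
    rfl

/-- The reversal is bookkeeping: the recursion peels off the last vector as the innermost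
derivative, while `partialDeriv` applies the head of the list first. Multi-indices do not see the
order. -/
lemma iteratedFDeriv_single {k : ℕ} {u : (ι → ℝ) → ℂ} (hu : ContDiff ℝ ∞ u) (j : Fin k → ι)
    (x : ι → ℝ) : iteratedFDeriv ℝ k u x (fun l => Pi.single (j l) (1 : ℝ)) =
      partialDeriv (List.ofFn j).reverse u x := by
  induction k generalizing u with
  | zero => simp [partialDeriv]
  | succ k ih =>
    rw [iteratedFDeriv_succ_apply_right, List.ofFn_succ', List.concat_eq_append,
      List.reverse_append, List.reverse_singleton, List.singleton_append, partialDeriv_cons,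
      ← ih (contDiff_dirDeriv hu _)]
    have h := (ContinuousLinearMap.apply ℝ ℂ
      (Pi.single (j (Fin.last k)) (1 : ℝ) : ι → ℝ)).iteratedFDeriv_comp_left (x := x)
      (hu.fderiv_right (m := ∞) (by simp)).contDiffAt (i := k) (by exact_mod_cast le_top)
    exact (congrArg (fun T => T fun l : Fin k => Pi.single (j l.castSucc) (1 : ℝ)) h).symm

omit [Fintype ι] in
lemma multiIndex_ofFn_reverse {k : ℕ} (j : Fin k → ι) (i : ι) :
    multiIndex (List.ofFn j).reverse i = (Finset.univ.filter fun l => j l = i).card := by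
  rw [multiIndex, List.count_reverse]
  induction k with
  | zero => simp
  | succ k ih =>
    rw [List.ofFn_succ, List.count_cons, ih, Fin.card_filter_univ_succ]
    by_cases h : j 0 = i <;> simp [h]

lemma gevreyBound_iff {s A C : ℝ} {u : (ι → ℝ) → ℂ} :
    GevreyBound s A C u ↔ ContDiff ℝ ∞ u ∧ ∀ (js : List ι) (x : ι → ℝ),
      ‖partialDeriv js u x‖ ≤ A * C ^ js.length * (multiFactorial (multiIndex js) : ℝ) ^ s := by
  refine and_congr_right fun hu => ⟨fun h js x => ?_, fun h k j x => ?_⟩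
  · have := h js.reverse.length js.reverse.get x
    rw [iteratedFDeriv_single hu] at this
    simp only [← multiIndex_ofFn_reverse, List.ofFn_get, List.reverse_reverse] at this
    rwa [List.length_reverse] at this
  · rw [iteratedFDeriv_single hu]
    have := h (List.ofFn j).reverse x
    simpa only [multiFactorial, multiIndex_ofFn_reverse, List.length_reverse, List.length_ofFn]
      using this

/-- A vector of the sup-norm unit ball has coordinates of modulus at most one, so each order costs a
factor `card ι`; the extra `1` keeps the factor at least one even when `ι` is empty. -/
lemma jetBound_of_partialDeriv {k : ℕ} {M : ℝ} {f : (ι → ℝ) → ℂ} {x : ι → ℝ}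
    (hf : ContDiff ℝ ∞ f) (h : ∀ js : List ι, js.length ≤ k → ‖partialDeriv js f x‖ ≤ M) :
    JetBound k ((Fintype.card ι + 1) ^ k * M) f x := by
  have h0 : ‖f x‖ ≤ M := h [] (Nat.zero_le _)
  have hM : 0 ≤ M := (norm_nonneg _).trans h0
  induction k generalizing f with
  | zero => simpa [JetBound] using h0
  | succ k ih =>
    refine ⟨h0.trans (le_mul_of_one_le_left hM (one_le_pow₀ (by simp))), fun v hv => ?_⟩
    have ev : v = ∑ i, v i • (Pi.single i (1 : ℝ) : ι → ℝ) := by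
      funext l
      simp [Pi.single_apply]
    rw [ev, dirDeriv_sum]
    simp only [dirDeriv_smul]
    have hi : ∀ i, JetBound k ((Fintype.card ι + 1) ^ k * M)
        (fun y => (v i : ℂ) * dirDeriv (Pi.single i (1 : ℝ)) f y) x := by
      intro i
      have h1 := ih (contDiff_dirDeriv hf (Pi.single i 1))
        (fun js hjs => h (i :: js) (by simpa using hjs)) (h [i] (by simp))
      refine (h1.const_mul (contDiff_dirDeriv hf _) (v i : ℂ)).mono ?_
      refine mul_le_of_le_one_left h1.nonneg ?_
      rw [Complex.norm_real]
      exact (norm_le_pi_norm v i).trans hv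
    refine (JetBound.sum Finset.univ (fun i => contDiff_const.mul (contDiff_dirDeriv hf _))
      fun i _ => hi i).mono ?_
    rw [Finset.sum_const, nsmul_eq_mul, Finset.card_univ, pow_succ]
    have : 0 ≤ ((Fintype.card ι : ℝ) + 1) ^ k * M := by positivity
    nlinarith

/-- Gevrey bounds `A C^{|β|} ((α+β)!)^s` with a shift `α`. -/
def ShiftedGevrey (s C A : ℝ) (α : ι → ℕ) (f : (ι → ℝ) → ℂ) : Prop :=
  ContDiff ℝ ∞ f ∧ ∀ (js : List ι) (x : ι → ℝ),
    ‖partialDeriv js f x‖ ≤ A * C ^ js.length * (multiFactorial (α + multiIndex js) : ℝ) ^ s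

lemma ShiftedGevrey.partial {s C A : ℝ} {α : ι → ℕ} {f : (ι → ℝ) → ℂ}
    (h : ShiftedGevrey s C A α f) (i : ι) :
    ShiftedGevrey s C (A * C) (α + Pi.single i 1) (dirDeriv (Pi.single i (1 : ℝ)) f) := by
  refine ⟨contDiff_dirDeriv h.1 _, fun js x => ?_⟩
  have := h.2 (i :: js) x
  rw [partialDeriv_cons, multiIndex_cons, ← add_assoc, List.length_cons, pow_succ'] at this
  rwa [mul_assoc A C]

/-- For `|β| ≤ k`, `(α+β)! ≤ 2^{|α|+k} α! k!`. This splits the bound into a constant depending on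
`k` and the part depending on `α`, which enters only through `2^{|α|} α!`. -/
lemma ShiftedGevrey.jetBound {s C A : ℝ} (hs : 0 ≤ s) (hC : 1 ≤ C) (hA : 0 ≤ A) {α : ι → ℕ}
    {f : (ι → ℝ) → ℂ} (h : ShiftedGevrey s C A α f) (k : ℕ) (x : ι → ℝ) :
    JetBound k (((Fintype.card ι + 1) ^ k * C ^ k * (2 ^ k * k.factorial : ℝ) ^ s) *
      (A * (2 ^ (∑ i, α i) * multiFactorial α : ℝ) ^ s)) f x := by
  refine (jetBound_of_partialDeriv (M := A * C ^ k * ((2 ^ k * k.factorial : ℝ) ^ s *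
    (2 ^ (∑ i, α i) * multiFactorial α : ℝ) ^ s)) h.1 fun js hjs => ?_).mono (le_of_eq (by ring))
  refine (h.2 js x).trans ?_
  rw [← Real.mul_rpow (by positivity) (by positivity)]
  have h1 : (multiFactorial (α + multiIndex js) : ℝ) ≤
      2 ^ k * k.factorial * (2 ^ (∑ i, α i) * multiFactorial α) := by
    have h2 := multiFactorial_add_le α (multiIndex js)
    have h3 := multiFactorial_le (multiIndex js)
    rw [sum_multiIndex] at h2 h3
    have h4 : multiFactorial (α + multiIndex js) ≤
        2 ^ k * k.factorial * (2 ^ (∑ i, α i) * multiFactorial α) := by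
      calc _ ≤ _ := h2
        _ ≤ 2 ^ (∑ i, α i + k) * (multiFactorial α * k.factorial) := by
          gcongr
          · norm_num
          · exact h3.trans (Nat.factorial_le hjs)
        _ = _ := by ring
    exact_mod_cast h4
  gcongr

lemma ShiftedGevrey.bddSmooth {s C A : ℝ} (hs : 0 ≤ s) (hC : 1 ≤ C) (hA : 0 ≤ A) {α : ι → ℕ}
    {f : (ι → ℝ) → ℂ} (h : ShiftedGevrey s C A α f) : BddSmooth f :=
  ⟨h.1, fun k => ⟨_, h.jetBound hs hC hA k⟩⟩

lemma GevreyBound.shiftedGevrey {s A C : ℝ} {f : (ι → ℝ) → ℂ} (h : GevreyBound s A C f) :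
    ShiftedGevrey s C A 0 f := by
  rw [gevreyBound_iff] at h
  exact ⟨h.1, by simpa only [zero_add] using h.2⟩

lemma GevreyBound.bddSmooth {s C A : ℝ} (hs : 0 ≤ s) (hC : 1 ≤ C) (hA : 0 ≤ A)
    {f : (ι → ℝ) → ℂ} (h : GevreyBound s A C f) : BddSmooth f :=
  h.shiftedGevrey.bddSmooth hs hC hA

/-- A translation invariant bilinear functional controlled by finitely many derivatives preserves
Gevrey regularity. -/
theorem gevreyBound_of_bilinear {s C : ℝ} (hs : 0 ≤ s) (hC : 1 ≤ C) {N : ℕ} {K : ℝ} (hK : 0 ≤ K)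
    {J : ((ι → ℝ) → ℂ) → ((ι → ℝ) → ℂ) → (ι → ℝ) → ℂ}
    (hJs : ∀ f g, BddSmooth f → BddSmooth g → ContDiff ℝ ∞ (J f g))
    (hJd : ∀ f g v, BddSmooth f → BddSmooth g →
      dirDeriv v (J f g) = fun p => J (dirDeriv v f) g p + J f (dirDeriv v g) p)
    (hJb : ∀ f g M M', BddSmooth f → BddSmooth g → (∀ x, JetBound N M f x) →
      (∀ x, JetBound N M' g x) → ∀ p, ‖J f g p‖ ≤ K * (M * M'))
    {A A' : ℝ} (hA : 0 ≤ A) (hA' : 0 ≤ A') {f g : (ι → ℝ) → ℂ} (hf : GevreyBound s A C f)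
    (hg : GevreyBound s A' C g) :
    GevreyBound s
      (K * ((Fintype.card ι + 1) ^ N * C ^ N * (2 ^ N * N.factorial : ℝ) ^ s) ^ 2 * (A * A'))
      (2 * C * 2 ^ s) (J f g) := by
  set D : ℝ := (Fintype.card ι + 1) ^ N * C ^ N * (2 ^ N * N.factorial : ℝ) ^ s with hD
  -- The shifts `α, β` record the derivatives already moved onto `f` and `g`, and `A, A'` the powers
  -- of `C` they have cost; all must vary in the induction.
  have main : ∀ (js : List ι) (f g : (ι → ℝ) → ℂ) (A A' : ℝ) (α β : ι → ℕ), 0 ≤ A → 0 ≤ A' →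
      ShiftedGevrey s C A α f → ShiftedGevrey s C A' β g → ∀ p,
      ‖partialDeriv js (J f g) p‖ ≤ K * D ^ 2 * (A * A') * (2 * C) ^ js.length *
        (2 ^ (∑ i, α i + ∑ i, β i + js.length) *
          multiFactorial (α + β + multiIndex js) : ℝ) ^ s := by
    intro js
    induction js with
    | nil =>
      intro f g A A' α β hA hA' hf hg p
      have h := hJb f g _ _ (hf.bddSmooth hs hC hA) (hg.bddSmooth hs hC hA')
        (hf.jetBound hs hC hA N) (hg.jetBound hs hC hA' N) p
      rw [← hD] at h
      refine h.trans ?_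
      have h0 : multiIndex ([] : List ι) = 0 := by
        funext i
        simp [multiIndex]
      simp only [List.length_nil, pow_zero, mul_one, add_zero, h0]
      have h1 : (2 ^ (∑ i, α i) * multiFactorial α : ℝ) ^ s *
          (2 ^ (∑ i, β i) * multiFactorial β : ℝ) ^ s ≤
          (2 ^ (∑ i, α i + ∑ i, β i) * multiFactorial (α + β) : ℝ) ^ s := by
        rw [← Real.mul_rpow (by positivity) (by positivity)]
        refine Real.rpow_le_rpow (by positivity) ?_ hs
        have h2 : (multiFactorial α * multiFactorial β : ℝ) ≤ multiFactorial (α + β) := by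
          exact_mod_cast multiFactorial_mul_le α β
        calc _ = (2 : ℝ) ^ (∑ i, α i + ∑ i, β i) * (multiFactorial α * multiFactorial β) := by
              ring
          _ ≤ _ := by gcongr
      calc _ = K * D ^ 2 * (A * A') * ((2 ^ (∑ i, α i) * multiFactorial α : ℝ) ^ s *
            (2 ^ (∑ i, β i) * multiFactorial β : ℝ) ^ s) := by ring
        _ ≤ _ := by gcongr
    | cons i js ih =>
      intro f g A A' α β hA hA' hf hg p
      have hf' := hf.bddSmooth hs hC hA
      have hg' := hg.bddSmooth hs hC hA'
      have hC0 : 0 ≤ C := zero_le_one.trans hC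
      -- The Leibniz rule gives two terms. Both raise `α + β` by the same unit multi-index and cost
      -- one factor `C`, so their bounds coincide and add up to a factor `2C`.
      rw [partialDeriv_cons, hJd f g _ hf' hg', partialDeriv_add js
        (hJs _ _ (hf'.dirDeriv _) hg') (hJs _ _ hf' (hg'.dirDeriv _))]
      have h1 := ih _ g (A * C) A' _ β (by positivity) hA' (hf.partial i) hg p
      have h2 := ih f _ A (A' * C) α _ hA (by positivity) hf (hg.partial i) p
      have hsum : ∑ l, (Pi.single i 1 : ι → ℕ) l = 1 := by simp
      have e1 : α + Pi.single i 1 + β + multiIndex js = α + β + multiIndex (i :: js) := by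
        rw [multiIndex_cons]
        abel
      have e2 : α + (β + Pi.single i 1) + multiIndex js = α + β + multiIndex (i :: js) := by
        rw [multiIndex_cons]
        abel
      simp only [Pi.add_apply, Finset.sum_add_distrib, hsum] at h1 h2
      rw [e1, show ∑ i, α i + 1 + ∑ i, β i + js.length =
        ∑ i, α i + ∑ i, β i + (i :: js).length by simp only [List.length_cons]; ring] at h1
      rw [e2, show ∑ i, α i + (∑ i, β i + 1) + js.length =
        ∑ i, α i + ∑ i, β i + (i :: js).length by simp only [List.length_cons]; ring] at h2
      refine (norm_add_le _ _).trans ((add_le_add h1 h2).trans (le_of_eq ?_))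
      rw [show (2 * C) ^ (i :: js).length = (2 * C) ^ js.length * (2 * C) from pow_succ _ _]
      ring
  rw [gevreyBound_iff]
  refine ⟨hJs f g (hf.bddSmooth hs hC hA) (hg.bddSmooth hs hC hA'), fun js x => ?_⟩
  refine (main js f g A A' 0 0 hA hA' hf.shiftedGevrey hg.shiftedGevrey x).trans (le_of_eq ?_)
  simp only [Pi.zero_apply, Finset.sum_const_zero, zero_add]
  -- With no initial shift the power of two is `(2^k)^s = (2^s)^k`, which is absorbed into the
  -- geometric constant.
  rw [Real.mul_rpow (by positivity) (by positivity), mul_pow (2 * C), ← Real.rpow_natCast 2,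
    ← Real.rpow_natCast ((2 : ℝ) ^ s), ← Real.rpow_mul zero_le_two, ← Real.rpow_mul zero_le_two,
    mul_comm s]
  ring

lemma GevreyBound.mono {s A A' C C' : ℝ} {u : (ι → ℝ) → ℂ} (h : GevreyBound s A C u)
    (hA : 0 ≤ A') (hAA : A ≤ A') (hC : 0 ≤ C) (hCC : C ≤ C') : GevreyBound s A' C' u := by
  refine ⟨h.1, fun k j x => (h.2 k j x).trans ?_⟩
  gcongr

end Gevrey

/-! ### The bilinear functional underlying the composition -/

section Bilinear

variable {E : Type*} [NormedAddCommGroup E] [NormedSpace ℝ E]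

lemma contDiff_tensor {f g : E → ℂ} (hf : ContDiff ℝ ∞ f) (hg : ContDiff ℝ ∞ g) :
    ContDiff ℝ ∞ (fun x : E × E => f x.1 * g x.2) :=
  (hf.comp contDiff_fst).mul (hg.comp contDiff_snd)

lemma jetBound_tensor {f g : E → ℂ} (hf : ContDiff ℝ ∞ f) (hg : ContDiff ℝ ∞ g) {k : ℕ}
    {M M' : ℝ} (h : ∀ x, JetBound k M f x) (h' : ∀ x, JetBound k M' g x) (x : E × E) :
    JetBound k (2 ^ k * (M * M')) (fun x : E × E => f x.1 * g x.2) x := by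
  have h1 := (h (ContinuousLinearMap.fst ℝ E E x + 0)).comp_affine hf _ _ le_rfl
    (ContinuousLinearMap.norm_fst_le ℝ E E)
  have h2 := (h' (ContinuousLinearMap.snd ℝ E E x + 0)).comp_affine hg _ _ le_rfl
    (ContinuousLinearMap.norm_snd_le ℝ E E)
  simp only [one_pow, one_mul, add_zero, ContinuousLinearMap.coe_fst',
    ContinuousLinearMap.coe_snd'] at h1 h2
  exact h1.mul (hf.comp contDiff_fst) (hg.comp contDiff_snd) h2

lemma bddSmooth_tensor {f g : E → ℂ} (hf : BddSmooth f) (hg : BddSmooth g) :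
    BddSmooth (fun x : E × E => f x.1 * g x.2) := by
  refine ⟨contDiff_tensor hf.1 hg.1, fun k => ?_⟩
  obtain ⟨M, hM⟩ := hf.2 k
  obtain ⟨M', hM'⟩ := hg.2 k
  exact ⟨_, jetBound_tensor hf.1 hg.1 hM hM'⟩

/-- The direction is diagonal because both factors are translated by the same parameter `p`; this is
the source of the Leibniz rule for `oscBilin`. -/
lemma dirDeriv_tensor {f g : E → ℂ} (hf : ContDiff ℝ ∞ f) (hg : ContDiff ℝ ∞ g) (v : E) :
    dirDeriv (v, v) (fun x : E × E => f x.1 * g x.2) =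
      fun x => dirDeriv v f x.1 * g x.2 + f x.1 * dirDeriv v g x.2 := by
  have h1 := dirDeriv_comp_affine hf (ContinuousLinearMap.fst ℝ E E) 0 (v, v)
  have h2 := dirDeriv_comp_affine hg (ContinuousLinearMap.snd ℝ E E) 0 (v, v)
  simp only [add_zero, ContinuousLinearMap.coe_fst', ContinuousLinearMap.coe_snd'] at h1 h2
  refine (dirDeriv_mul (F := fun x : E × E => f x.1) (G := fun x : E × E => g x.2)
    (hf.comp contDiff_fst) (hg.comp contDiff_snd) (v, v)).trans ?_
  change (fun w => dirDeriv (v, v) (fun x : E × E => f x.1) w * g w.2 +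
    f w.1 * dirDeriv (v, v) (fun x : E × E => g x.2) w) = _
  rw [h1, h2]

variable {W : Type*} [NormedAddCommGroup W] [NormedSpace ℝ W] [FiniteDimensional ℝ W]
  [MeasurableSpace W] [BorelSpace W] (μ : MeasureTheory.Measure W) [μ.IsAddHaarMeasure]
  {B : W →L[ℝ] W →L[ℝ] ℝ} {ψ : W → ℂ}

/-- The oscillatory integral `∫ ψ(w) f(p + A₁ w) g(p + A₂ w) dμ(w)`. -/
def oscBilin (ψ : W → ℂ) (A : W →L[ℝ] E × E) (f g : E → ℂ) (p : E) : ℂ :=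
  oscParam μ ψ A (fun x => f x.1 * g x.2) (p, p)

variable [FiniteDimensional ℝ E] (hψ : IsPhase ψ B) (hB : ∀ w, (∀ v, B w v = 0) → w = 0)
  (A : W →L[ℝ] E × E)
include hψ hB

lemma contDiff_oscBilin {f g : E → ℂ} (hf : BddSmooth f) (hg : BddSmooth g) :
    ContDiff ℝ ∞ (oscBilin μ ψ A f g) :=
  (contDiff_oscParam μ hψ hB A (bddSmooth_tensor hf hg)).comp (contDiff_id.prodMk contDiff_id)

lemma dirDeriv_oscBilin {f g : E → ℂ} (hf : BddSmooth f) (hg : BddSmooth g) (v : E) :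
    dirDeriv v (oscBilin μ ψ A f g) =
      fun p => oscBilin μ ψ A (dirDeriv v f) g p + oscBilin μ ψ A f (dirDeriv v g) p := by
  have h := dirDeriv_comp_affine (contDiff_oscParam μ hψ hB A (bddSmooth_tensor hf hg))
    ((ContinuousLinearMap.id ℝ E).prod (ContinuousLinearMap.id ℝ E)) 0 v
  simp only [add_zero, ContinuousLinearMap.prod_apply, ContinuousLinearMap.id_apply] at h
  change dirDeriv v (fun p => oscParam μ ψ A (fun x => f x.1 * g x.2) (p, p)) = _
  rw [h, dirDeriv_oscParam μ hψ hB A (bddSmooth_tensor hf hg), dirDeriv_tensor hf.1 hg.1]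
  funext p
  exact oscParam_add μ hψ hB A (bddSmooth_tensor (hf.dirDeriv v) hg)
    (bddSmooth_tensor hf (hg.dirDeriv v)) (p, p)

end Bilinear

/-! ### The phase `e^{-2iσ(Y,Z)}` -/

section SymplecticPhase

variable {V : Type*} [NormedAddCommGroup V] [NormedSpace ℝ V]

/-- A bilinear form on a finite-dimensional space as a continuous bilinear form. -/
def continuousBilin [FiniteDimensional ℝ V] (σ : V →ₗ[ℝ] V →ₗ[ℝ] ℝ) : V →L[ℝ] V →L[ℝ] ℝ :=
  LinearMap.toContinuousLinearMap
    ((LinearMap.toContinuousLinearMap : (V →ₗ[ℝ] ℝ) ≃ₗ[ℝ] (V →L[ℝ] ℝ)).toLinearMap ∘ₗ σ)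

/-- The symmetric bilinear form associated with the quadratic form `4 σ(Y, Z)` on `V × V`. -/
def phaseForm (σ : V →L[ℝ] V →L[ℝ] ℝ) : (V × V) →L[ℝ] (V × V) →L[ℝ] ℝ :=
  let T := σ.bilinearComp (ContinuousLinearMap.fst ℝ V V) (ContinuousLinearMap.snd ℝ V V)
  (2 : ℝ) • (T + T.flip)

lemma phaseForm_apply (σ : V →L[ℝ] V →L[ℝ] ℝ) (w v : V × V) :
    phaseForm σ w v = 2 * (σ w.1 v.2 + σ v.1 w.2) := by
  simp [phaseForm]
  ring

lemma phaseForm_nondegenerate {σ : V →L[ℝ] V →L[ℝ] ℝ} (h₁ : ∀ x, (∀ y, σ x y = 0) → x = 0)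
    (h₂ : ∀ y, (∀ x, σ x y = 0) → y = 0) (w : V × V) (hw : ∀ v, phaseForm σ w v = 0) :
    w = 0 := by
  refine Prod.ext (h₁ _ fun y => ?_) (h₂ _ fun x => ?_)
  · simpa [phaseForm_apply] using hw (0, y)
  · simpa [phaseForm_apply] using hw (x, 0)

lemma isPhase_exp (σ : V →L[ℝ] V →L[ℝ] ℝ) :
    IsPhase (fun w : V × V => Complex.exp (-2 * Complex.I * (σ w.1 w.2 : ℂ))) (phaseForm σ) := by
  have hs : ContDiff ℝ ∞ (fun w : V × V => σ w.1 w.2) :=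
    (σ.contDiff.comp contDiff_fst).clm_apply contDiff_snd
  refine ⟨?_, fun w => ?_, fun w v => ?_⟩
  · exact (contDiff_const.mul (Complex.ofRealCLM.contDiff.comp hs)).cexp
  · rw [Complex.norm_exp]
    simp
  · have h1 : HasFDerivAt (fun w : V × V => σ w.1 w.2)
        (fderiv ℝ (fun w : V × V => σ w.1 w.2) w) w :=
      (hs.differentiable (by simp) w).hasFDerivAt
    have h2 : fderiv ℝ (fun w : V × V => σ w.1 w.2) w v = σ w.1 v.2 + σ v.1 w.2 := by
      have := σ.hasFDerivAt_of_bilinear (hasFDerivAt_fst (𝕜 := ℝ) (p := w))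
        (hasFDerivAt_snd (𝕜 := ℝ) (p := w))
      rw [this.fderiv]
      simp
    have h3 := ((Complex.ofRealCLM.hasFDerivAt.comp w h1).const_mul (-2 * Complex.I)).cexp
    have h4 := congrArg (fun T => T v) h3.fderiv
    refine h4.trans ?_
    simp [h2, phaseForm_apply]
    ring

end SymplecticPhase

/-! ### The symplectic form on `Λ_Φ` -/

section Symplectic

variable {n : ℕ} (Φ : QuadraticForm ℝ (Fin n → ℂ))

/-- Any real linear form `f` yields the complex linear form `z ↦ f(z) - i f(iz)`, which is
determined by its values on the standard basis. -/
lemma sum_mul_eq_of_linear (f : (Fin n → ℂ) →ₗ[ℝ] ℝ) (z : Fin n → ℂ) :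
    ∑ k, ((f (Pi.single k 1) : ℂ) - Complex.I * (f (Pi.single k Complex.I) : ℂ)) * z k =
      (f z : ℂ) - Complex.I * (f (Complex.I • z) : ℂ) := by
  have h : ∀ z : Fin n → ℂ, f z =
      ∑ k, ((z k).re * f (Pi.single k 1) + (z k).im * f (Pi.single k Complex.I)) := by
    intro z
    have hz : z = ∑ k, ((z k).re • (Pi.single k 1 : Fin n → ℂ) +
        (z k).im • (Pi.single k Complex.I : Fin n → ℂ)) := by
      funext l
      simp only [Finset.sum_apply, Pi.add_apply, Pi.smul_apply, Pi.single_apply]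
      rw [Finset.sum_eq_single l (fun k _ hk => by simp [hk.symm]) (by simp)]
      simp
    conv_lhs => rw [hz]
    simp
  rw [h z, h (Complex.I • z)]
  push_cast
  rw [Finset.mul_sum, ← Finset.sum_sub_distrib]
  refine Finset.sum_congr rfl fun k _ => ?_
  simp
  linear_combination (-(f (Pi.single k Complex.I) : ℂ) * (z k).im) * Complex.I_sq -
    ((f (Pi.single k 1) : ℂ) - Complex.I * (f (Pi.single k Complex.I) : ℂ)) *
      Complex.re_add_im (z k)

lemma dHol_eq (k : Fin n) (x : Fin n → ℂ) : dHol k (fun y => (Φ y : ℂ)) x =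
    (1 / 2) * ((Φ.polarBilin x (Pi.single k 1) : ℂ) -
      Complex.I * (Φ.polarBilin x (Pi.single k Complex.I) : ℂ)) := by
  simp [dHol, fderiv_quadraticForm]

lemma sum_dHol_mul (x z : Fin n → ℂ) : ∑ k, dHol k (fun y => (Φ y : ℂ)) x * z k =
    (1 / 2) * ((Φ.polarBilin x z : ℂ) - Complex.I * (Φ.polarBilin x (Complex.I • z) : ℂ)) := by
  rw [← sum_mul_eq_of_linear, Finset.mul_sum]
  simp only [dHol_eq, mul_assoc]

/-- Pairing the momentum at `x` with `y` gives `-i b(x,y) - b(x,iy)`, with `b` the polar form of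
`Φ`. The imaginary parts cancel by symmetry of `b`, so `σ` is real on `Λ_Φ`. -/
lemma sigma_point (x y : Fin n → ℂ) : sigma (point Φ x).1 (point Φ y).1 =
    ((Φ.polarBilin y (Complex.I • x) - Φ.polarBilin x (Complex.I • y) : ℝ) : ℂ) := by
  have h : ∀ x y : Fin n → ℂ, ∑ j, momentum Φ x j * y j =
      -Complex.I * (Φ.polarBilin x y : ℂ) - (Φ.polarBilin x (Complex.I • y) : ℂ) := by
    intro x y
    simp only [momentum, mul_assoc]
    rw [← Finset.mul_sum, sum_dHol_mul]
    have : (2 : ℂ) / Complex.I = -2 * Complex.I := by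
      rw [div_eq_mul_inv, Complex.inv_I]
      ring
    rw [this]
    linear_combination (Φ.polarBilin x (Complex.I • y) : ℂ) * Complex.I_sq
  change ∑ j, (momentum Φ x j * y j - momentum Φ y j * x j) = _
  rw [Finset.sum_sub_distrib, h, h]
  have : Φ.polarBilin x y = Φ.polarBilin y x := QuadraticMap.polar_comm _ _ _
  rw [this]
  push_cast
  ring

lemma sum_leviMatrix (x z : Fin n → ℂ) :
    star z ⬝ᵥ (leviMatrix (fun x => Φ x) x).mulVec z =
      ((1 / 4 * (Φ.polarBilin z z + Φ.polarBilin (Complex.I • z) (Complex.I • z)) : ℝ) : ℂ) := by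
  have hd : ∀ k v, fderiv ℝ (dHol k fun y => (Φ y : ℂ)) x v = dHol k (fun y => (Φ y : ℂ)) v := by
    intro k v
    let T : (Fin n → ℂ) →ₗ[ℝ] ℂ :=
      { toFun := dHol k fun y => (Φ y : ℂ)
        map_add' := fun u v => by
          simp only [dHol_eq, map_add, LinearMap.add_apply]
          push_cast
          ring
        map_smul' := fun c v => by
          simp only [dHol_eq, map_smul, LinearMap.smul_apply, smul_eq_mul, Complex.real_smul,
            RingHom.id_apply]
          push_cast
          ring }
    exact congrArg (fun S => S v) (LinearMap.toContinuousLinearMap T).fderiv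
  have h1 : ∀ j, (leviMatrix (fun x => Φ x) x).mulVec z j =
      (1 / 4) * (((Φ.polarBilin (Pi.single j 1) z : ℂ) -
        Complex.I * (Φ.polarBilin (Pi.single j 1) (Complex.I • z) : ℂ)) + Complex.I *
        ((Φ.polarBilin (Pi.single j Complex.I) z : ℂ) -
        Complex.I * (Φ.polarBilin (Pi.single j Complex.I) (Complex.I • z) : ℂ))) := by
    intro j
    simp only [Matrix.mulVec, dotProduct, leviMatrix, Matrix.of_apply, dAntihol, hd]
    have e : ∀ k, 1 / 2 * (dHol k (fun y => (Φ y : ℂ)) (Pi.single j 1) +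
        Complex.I * dHol k (fun y => (Φ y : ℂ)) (Pi.single j Complex.I)) * z k =
        1 / 2 * (dHol k (fun y => (Φ y : ℂ)) (Pi.single j 1) * z k) + Complex.I / 2 *
          (dHol k (fun y => (Φ y : ℂ)) (Pi.single j Complex.I) * z k) := fun k => by ring
    simp only [e]
    rw [Finset.sum_add_distrib, ← Finset.mul_sum, ← Finset.mul_sum, sum_dHol_mul, sum_dHol_mul]
    ring
  have h2 : ∀ f : (Fin n → ℂ) →ₗ[ℝ] ℝ, ∑ j, star (z j) *
      ((f (Pi.single j 1) : ℂ) + Complex.I * (f (Pi.single j Complex.I) : ℂ)) =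
      (f z : ℂ) + Complex.I * (f (Complex.I • z) : ℂ) := by
    intro f
    have := congrArg (starRingEnd ℂ) (sum_mul_eq_of_linear f z)
    simp only [map_sum, map_mul, map_sub, Complex.conj_ofReal, Complex.conj_I, neg_mul,
      sub_neg_eq_add] at this
    rw [← this]
    exact Finset.sum_congr rfl fun j _ => mul_comm _ _
  have h3 := h2 (Φ.polarBilin.flip z)
  have h4 := h2 (Φ.polarBilin.flip (Complex.I • z))
  simp only [LinearMap.flip_apply] at h3 h4
  have e : star z ⬝ᵥ (leviMatrix (fun x => Φ x) x).mulVec z =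
      1 / 4 * (∑ j, star (z j) * ((Φ.polarBilin (Pi.single j 1) z : ℂ) +
        Complex.I * (Φ.polarBilin (Pi.single j Complex.I) z : ℂ))) -
      Complex.I / 4 * (∑ j, star (z j) * ((Φ.polarBilin (Pi.single j 1) (Complex.I • z) : ℂ) +
        Complex.I * (Φ.polarBilin (Pi.single j Complex.I) (Complex.I • z) : ℂ))) := by
    simp only [dotProduct, h1, Pi.star_apply]
    rw [Finset.mul_sum, Finset.mul_sum, ← Finset.sum_sub_distrib]
    exact Finset.sum_congr rfl fun j _ => by ring
  rw [e, h3, h4]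
  have : Φ.polarBilin (Complex.I • z) z = Φ.polarBilin z (Complex.I • z) :=
    QuadraticMap.polar_comm _ _ _
  rw [this]
  push_cast
  linear_combination (-(1 / 4) * (Φ.polarBilin (Complex.I • z) (Complex.I • z) : ℂ)) *
    Complex.I_sq

/-- `Λ_Φ` parametrized by its projection to `ℂⁿ`. -/
def pointEquiv : (Fin n → ℂ) ≃L[ℝ] Lam Φ :=
  LinearEquiv.toContinuousLinearEquiv
    { toFun := point Φ
      invFun := fun X => X.1.1
      map_add' := fun x y => by
        obtain ⟨z, hz⟩ := (point Φ x + point Φ y).2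
        have h1 : z = x + y := congrArg Prod.fst hz
        exact Subtype.ext (by rw [← h1]; exact hz)
      map_smul' := fun c x => by
        obtain ⟨z, hz⟩ := (c • point Φ x).2
        have h1 : z = c • x := congrArg Prod.fst hz
        exact Subtype.ext (by rw [← h1]; exact hz)
      left_inv := fun x => rfl
      right_inv := fun X => by
        obtain ⟨z, hz⟩ := X.2
        have h1 : z = X.1.1 := congrArg Prod.fst hz
        exact Subtype.ext ((congrArg (fun z => (z, momentum Φ z)) h1.symm).trans hz) }

lemma pointEquiv_apply (x : Fin n → ℂ) : pointEquiv Φ x = point Φ x := rfl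

/-- The identification `ℝ²ⁿ ≃ ℂⁿ` as a linear equivalence. -/
def ofReal2Equiv (n : ℕ) : (Fin n ⊕ Fin n → ℝ) ≃L[ℝ] (Fin n → ℂ) :=
  LinearEquiv.toContinuousLinearEquiv
    { toFun := ofReal2
      invFun := fun z => Sum.elim (fun j => (z j).re) (fun j => (z j).im)
      map_add' := fun p q => by
        funext j
        simp [ofReal2]
        ring
      map_smul' := fun c p => by
        funext j
        simp [ofReal2]
        ring
      left_inv := fun p => by
        funext j
        cases j <;> simp [ofReal2]
      right_inv := fun z => by
        funext j
        simp [ofReal2, mul_comm Complex.I, Complex.re_add_im] }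

/-- Linear coordinates on `Λ_Φ`. -/
def coord : (Fin n ⊕ Fin n → ℝ) ≃L[ℝ] Lam Φ := (ofReal2Equiv n).trans (pointEquiv Φ)

lemma coord_apply (p : Fin n ⊕ Fin n → ℝ) : coord Φ p = point Φ (ofReal2 p) := rfl

lemma finrank_lam : Module.finrank ℝ (Lam Φ) = 2 * n := by
  rw [← (coord Φ).toLinearEquiv.finrank_eq]
  simp
  ring

/-- The restriction of `σ` to `Λ_Φ`, a real bilinear form. -/
def sigmaBilin : Lam Φ →ₗ[ℝ] Lam Φ →ₗ[ℝ] ℝ :=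
  LinearMap.mk₂ ℝ (fun X Y : Lam Φ => (sigma X.1 Y.1).re)
    (fun X Y Z => by
      simp only [sigma, ← Complex.add_re, ← Finset.sum_add_distrib]
      exact congrArg Complex.re (Finset.sum_congr rfl fun j _ => by simp; ring))
    (fun c X Y => by
      rw [smul_eq_mul, ← Complex.re_ofReal_mul, sigma, sigma, Finset.mul_sum]
      exact congrArg Complex.re (Finset.sum_congr rfl fun j _ => by simp; ring))
    (fun X Y Z => by
      simp only [sigma, ← Complex.add_re, ← Finset.sum_add_distrib]
      exact congrArg Complex.re (Finset.sum_congr rfl fun j _ => by simp; ring))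
    (fun c X Y => by
      rw [smul_eq_mul, ← Complex.re_ofReal_mul, sigma, sigma, Finset.mul_sum]
      exact congrArg Complex.re (Finset.sum_congr rfl fun j _ => by simp; ring))

/-- The restriction of `σ` to `Λ_Φ`, a continuous real bilinear form. -/
def sigmaLam : Lam Φ →L[ℝ] Lam Φ →L[ℝ] ℝ := continuousBilin (sigmaBilin Φ)

lemma sigmaLam_apply (X Y : Lam Φ) : sigmaLam Φ X Y = (sigma X.1 Y.1).re := rfl

lemma ofReal_sigmaLam (X Y : Lam Φ) : (sigmaLam Φ X Y : ℂ) = sigma X.1 Y.1 := by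
  obtain ⟨x, rfl⟩ := (pointEquiv Φ).surjective X
  obtain ⟨y, rfl⟩ := (pointEquiv Φ).surjective Y
  rw [sigmaLam_apply, pointEquiv_apply, pointEquiv_apply, sigma_point, Complex.ofReal_re]

lemma sigmaLam_antisymm (X Y : Lam Φ) : sigmaLam Φ X Y = -sigmaLam Φ Y X := by
  simp only [sigmaLam_apply, sigma, ← Complex.neg_re, ← Finset.sum_neg_distrib]
  exact congrArg Complex.re (Finset.sum_congr rfl fun j _ => by ring)

variable {Φ}

/-- Testing against the point above `ix` gives `b(ix,ix) + b(x,x)`, which by `sum_leviMatrix` is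
four times the Levi form at `x`, hence positive for `x ≠ 0`. -/
lemma sigmaLam_nondegenerate (hΦ : StrictlyPlurisubharmonic fun x => Φ x) (X : Lam Φ)
    (hX : ∀ Y, sigmaLam Φ X Y = 0) : X = 0 := by
  obtain ⟨x, rfl⟩ := (pointEquiv Φ).surjective X
  by_contra hx
  have hx0 : x ≠ 0 := fun h => hx (by rw [h, map_zero])
  have h1 := hX (pointEquiv Φ (Complex.I • x))
  rw [sigmaLam_apply, pointEquiv_apply, pointEquiv_apply, sigma_point, Complex.ofReal_re,
    smul_smul, Complex.I_mul_I, neg_one_smul, map_neg] at h1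
  have h2 := (hΦ.2 0).dotProduct_mulVec_pos hx0
  rw [sum_leviMatrix] at h2
  have h3 := Complex.zero_lt_real.1 h2
  linarith

/-- A kernel vector of the Gram matrix is a vector `σ`-orthogonal to a basis. Nonvanishing makes the
density of the symplectic volume positive, so that it is a Haar measure. -/
lemma det_sigmaGram_ne_zero (hΦ : StrictlyPlurisubharmonic fun x => Φ x) :
    (sigmaGram Φ).det ≠ 0 := by
  let G : Matrix (Fin n ⊕ Fin n) (Fin n ⊕ Fin n) ℝ :=
    Matrix.of fun i j => sigmaLam Φ (coord Φ (Pi.single i 1)) (coord Φ (Pi.single j 1))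
  have hG : sigmaGram Φ = G.map (algebraMap ℝ ℂ) := by
    ext i j
    simp [G, sigmaGram, ofReal_sigmaLam, coord_apply]
  rw [hG, ← RingHom.mapMatrix_apply, ← RingHom.map_det]
  intro h
  have h0 : G.det = 0 := by simpa using h
  obtain ⟨v, hv, hGv⟩ := Matrix.exists_mulVec_eq_zero_iff.2 h0
  have h1 : ∀ i, sigmaLam Φ (coord Φ v) (coord Φ (Pi.single i 1)) = 0 := by
    intro i
    have h2 := congrFun hGv i
    have ev : v = ∑ j, v j • (Pi.single j (1 : ℝ) : Fin n ⊕ Fin n → ℝ) := by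
      funext l
      simp [Pi.single_apply]
    rw [sigmaLam_antisymm, neg_eq_zero]
    conv_lhs => rw [ev]
    simp only [map_sum, map_smul, smul_eq_mul]
    simpa [Matrix.mulVec, dotProduct, G, mul_comm] using h2
  refine hv ((coord Φ).injective (((sigmaLam_nondegenerate hΦ _ fun Y => ?_)).trans
    (map_zero (coord Φ)).symm))
  obtain ⟨q, rfl⟩ := (coord Φ).surjective Y
  have h3 : ((sigmaLam Φ (coord Φ v)).comp (coord Φ).toContinuousLinearMap).toLinearMap = 0 :=
    (Pi.basisFun ℝ (Fin n ⊕ Fin n)).ext fun i => by simpa using h1 i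
  exact congrArg (fun T => T q) h3

lemma isAddHaarMeasure_symplecticVolume (hΦ : StrictlyPlurisubharmonic fun x => Φ x) :
    (symplecticVolume Φ).IsAddHaarMeasure := by
  have h : ((MeasureTheory.volume : MeasureTheory.Measure (Fin n → ℂ)).map
      (pointEquiv Φ)).IsAddHaarMeasure := (pointEquiv Φ).isAddHaarMeasure_map _
  refine MeasureTheory.Measure.IsAddHaarMeasure.smul
    ((MeasureTheory.volume : MeasureTheory.Measure (Fin n → ℂ)).map (pointEquiv Φ)) ?_
    ENNReal.ofReal_ne_top
  have := norm_pos_iff.2 (det_sigmaGram_ne_zero hΦ)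
  exact (ENNReal.ofReal_pos.2 (Real.sqrt_pos.2 this)).ne'

end Symplectic

/-! ### The Weyl composition -/

section ScaledProd

variable {V E : Type*} [NormedAddCommGroup V] [NormedSpace ℝ V] [NormedAddCommGroup E]
  [NormedSpace ℝ E]

/-- The map `(Y, Z) ↦ c (L Y, L Z)`. -/
def scaledProd (L : V →L[ℝ] E) (c : ℝ) : V × V →L[ℝ] E × E := c • L.prodMap L

lemma scaledProd_apply (L : V →L[ℝ] E) (c : ℝ) (w : V × V) :
    scaledProd L c w = (c • L w.1, c • L w.2) := rfl

lemma norm_scaledProd_le (L : V →L[ℝ] E) {c : ℝ} (hc : 0 ≤ c) (hc' : c ≤ 1) :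
    ‖scaledProd L c‖ ≤ max 1 ‖L‖ := by
  refine ContinuousLinearMap.opNorm_le_bound _ (by positivity) fun w => ?_
  have h : ∀ v : V, ‖v‖ ≤ ‖w‖ → ‖c • L v‖ ≤ max 1 ‖L‖ * ‖w‖ := by
    intro v hv
    rw [norm_smul, Real.norm_eq_abs, abs_of_nonneg hc]
    refine (mul_le_of_le_one_left (norm_nonneg _) hc').trans ((L.le_opNorm v).trans ?_)
    gcongr
    exact le_max_right _ _
  rw [scaledProd_apply]
  exact max_le (h _ (norm_fst_le w)) (h _ (norm_snd_le w))

variable [FiniteDimensional ℝ V] [MeasurableSpace V] [BorelSpace V]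

lemma borelSpace_prod : BorelSpace (V × V) :=
  have : ProperSpace V := FiniteDimensional.proper ℝ V
  inferInstance

lemma isAddHaarMeasure_prod (μ : MeasureTheory.Measure V) [μ.IsAddHaarMeasure] :
    (μ.prod μ).IsAddHaarMeasure :=
  have : ProperSpace V := FiniteDimensional.proper ℝ V
  inferInstance

/-- The composition of symbols on a symplectic vector space as an oscillatory integral, with
Gevrey bounds that are uniform in `h`. -/
theorem exists_composition {ι : Type*} [Fintype ι] [DecidableEq ι] (μ : MeasureTheory.Measure V)
    [μ.IsAddHaarMeasure] {σ : V →L[ℝ] V →L[ℝ] ℝ} (h₁ : ∀ x, (∀ y, σ x y = 0) → x = 0)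
    (h₂ : ∀ y, (∀ x, σ x y = 0) → y = 0) (e : (ι → ℝ) ≃L[ℝ] V) (κ : ℂ) {s A A' C : ℝ}
    (hs : 0 ≤ s) (hC : 1 ≤ C) (hA : 0 ≤ A) (hA' : 0 ≤ A') :
    ∃ D > 0, ∃ C' > 0, ∀ h ∈ Set.Ioc (0 : ℝ) 1, ∀ a b : V → ℂ,
      GevreyBound s A C (fun p => a (e p)) → GevreyBound s A' C (fun p => b (e p)) →
      ∃ c : V → ℂ, (∀ X, HasOscillatoryIntegral (μ.prod μ)
        (fun w : V × V => Complex.exp (-2 * Complex.I * (σ w.1 w.2 : ℂ) / h) *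
          a (X + w.1) * b (X + w.2)) ((h : ℂ) ^ Module.finrank ℝ V * c X)) ∧
        GevreyBound s D C' (fun p => κ * c (e p)) := by
  have : BorelSpace (V × V) := borelSpace_prod
  have := isAddHaarMeasure_prod μ
  have hψ := isPhase_exp σ
  have hB := phaseForm_nondegenerate h₁ h₂
  set ψ : V × V → ℂ := fun w => Complex.exp (-2 * Complex.I * (σ w.1 w.2 : ℂ)) with hψ_def
  let L := e.symm.toContinuousLinearMap
  obtain ⟨N, K, hK, hbound⟩ := exists_oscParam_bound (X := (ι → ℝ) × (ι → ℝ)) (μ.prod μ) hψ hB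
    (le_max_left 1 ‖L‖)
  set K₁ := ‖κ‖ * (K * 2 ^ N)
  set D : ℝ := K₁ * ((Fintype.card ι + 1) ^ N * C ^ N * (2 ^ N * N.factorial : ℝ) ^ s) ^ 2 *
    (A * A')
  have hK₁ : 0 ≤ K₁ := by positivity
  refine ⟨D + 1, by positivity, 2 * C * 2 ^ s, by positivity, fun h hh a b ha hb => ?_⟩
  set f : (ι → ℝ) → ℂ := fun p => a (e p) with hf_def
  set g : (ι → ℝ) → ℂ := fun p => b (e p) with hg_def
  have hr : 0 < Real.sqrt h := Real.sqrt_pos.2 hh.1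
  have hnorm : ‖scaledProd L (Real.sqrt h)‖ ≤ max 1 ‖L‖ :=
    norm_scaledProd_le L hr.le (Real.sqrt_le_one.2 hh.2)
  -- After the substitution `w ↦ √h w` the phase is free of `h`, which survives only in the map `w ↦
  -- √h (L Y, L Z)`.
  refine ⟨fun X => oscBilin (μ.prod μ) ψ (scaledProd L (Real.sqrt h)) f g (e.symm X),
    fun X => ?_, ?_⟩
  · have h1 := (hbound _ hnorm _ (bddSmooth_tensor (ha.bddSmooth hs hC hA)
      (hb.bddSmooth hs hC hA')) (e.symm X, e.symm X)).1
    -- The Jacobian on `V × V` is `(√h)^{2 dim V} = h^{dim V}`.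
    have hpow : (h : ℂ) ^ Module.finrank ℝ V =
        ((Real.sqrt h : ℝ) : ℂ) ^ Module.finrank ℝ (V × V) := by
      have hsq : ((Real.sqrt h : ℝ) : ℂ) ^ 2 = h := by exact_mod_cast Real.sq_sqrt hh.1.le
      rw [Module.finrank_prod, ← two_mul, pow_mul, hsq]
    rw [hpow]
    refine HasOscillatoryIntegral.of_comp_smul (μ.prod μ) hr ?_
    convert h1 using 1
    swap
    · rfl
    funext w
    have e1 : -2 * Complex.I * (σ (Real.sqrt h • w).1 (Real.sqrt h • w).2 : ℂ) / h =
        -2 * Complex.I * (σ w.1 w.2 : ℂ) := by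
      rw [Prod.smul_fst, Prod.smul_snd, map_smul, map_smul, smul_apply, smul_eq_mul, smul_eq_mul,
        ← mul_assoc, Real.mul_self_sqrt hh.1.le]
      have : (h : ℂ) ≠ 0 := by exact_mod_cast hh.1.ne'
      push_cast
      field_simp
    have e2 : e (scaledProd L (Real.sqrt h) w + (e.symm X, e.symm X)).1 =
        X + Real.sqrt h • w.1 := by
      simp [L, scaledProd_apply, add_comm]
    have e3 : e (scaledProd L (Real.sqrt h) w + (e.symm X, e.symm X)).2 =
        X + Real.sqrt h • w.2 := by
      simp [L, scaledProd_apply, add_comm]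
    simp only [hf_def, hg_def, e2, e3]
    rw [e1, mul_assoc]
    rfl
  · simp only [ContinuousLinearEquiv.symm_apply_apply]
    refine GevreyBound.mono (A := D) ?_ (by positivity) (by linarith) (by positivity) le_rfl
    exact gevreyBound_of_bilinear (N := N) (K := K₁) hs hC hK₁
      (J := fun f g p => κ * oscBilin (μ.prod μ) ψ (scaledProd L (Real.sqrt h)) f g p)
      (fun f g hf hg => contDiff_const.mul (contDiff_oscBilin _ hψ hB _ hf hg))
      (fun f g v hf hg => by
        rw [dirDeriv_const_mul (contDiff_oscBilin _ hψ hB _ hf hg),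
          dirDeriv_oscBilin _ hψ hB _ hf hg]
        funext p
        ring)
      (fun f g M M' hf hg hM hM' p => by
        have h1 := (hbound _ hnorm _ (bddSmooth_tensor hf hg) (p, p)).2 _
          (jetBound_tensor hf.1 hg.1 hM hM')
        rw [norm_mul]
        refine (mul_le_mul_of_nonneg_left h1 (norm_nonneg κ)).trans (le_of_eq ?_)
        ring)
      hA hA' ha hb

end ScaledProd

end GevreyWeyl

end

open GevreyWeyl in
theorem mainTheorem11 {n : ℕ} (Φ : QuadraticForm ℝ (Fin n → ℂ))
    (hΦ : GevreyWeyl.StrictlyPlurisubharmonic fun x => Φ x) {s : ℝ} (hs : 1 < s)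
    (a b : ℝ → GevreyWeyl.Lam Φ → ℂ)
    (ha : GevreyWeyl.IsGevreySymbol Φ s a) (hb : GevreyWeyl.IsGevreySymbol Φ s b) :
    (∀ h ∈ Set.Ioc (0 : ℝ) 1, ∀ X : GevreyWeyl.Lam Φ, ∃ L : ℂ,
      GevreyWeyl.HasOscillatoryIntegral
        ((GevreyWeyl.symplecticVolume Φ).prod (GevreyWeyl.symplecticVolume Φ))
        (GevreyWeyl.compIntegrand Φ h (a h) (b h) X) L) ∧
    GevreyWeyl.IsGevreySymbol Φ s (fun h => GevreyWeyl.weylComp Φ h (a h) (b h)) := by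
  have hμ := isAddHaarMeasure_symplecticVolume hΦ
  obtain ⟨A, hA, C, hC, ha⟩ := ha
  obtain ⟨A', hA', C', hC', hb⟩ := hb
  -- The constant `π^{-2n}` is passed as `κ`; the remaining `h^{-2n}` of the prefactor cancels
  -- against the Jacobian. Both symbols are given the common constant `max 1 (max C C')`.
  obtain ⟨D, hD, C₁, hC₁, H⟩ := exists_composition (symplecticVolume Φ)
    (sigmaLam_nondegenerate hΦ) (fun Y hY => sigmaLam_nondegenerate hΦ Y fun X => by
      rw [sigmaLam_antisymm, hY, neg_zero]) (coord Φ) (1 / (Real.pi : ℂ) ^ (2 * n))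
    (s := s) (C := max 1 (max C C')) (by linarith) (le_max_left _ _) hA.le hA'.le
  have H' : ∀ h ∈ Set.Ioc (0 : ℝ) 1, ∃ c : Lam Φ → ℂ,
      (∀ X, HasOscillatoryIntegral ((symplecticVolume Φ).prod (symplecticVolume Φ))
        (compIntegrand Φ h (a h) (b h) X) ((h : ℂ) ^ (2 * n) * c X)) ∧
        GevreyBound s D C₁ (fun p => 1 / (Real.pi : ℂ) ^ (2 * n) * c (coord Φ p)) := by
    intro h hh
    obtain ⟨c, hc, hc'⟩ := H h hh (a h) (b h)
      ((ha h hh).mono hA.le le_rfl hC.le ((le_max_left _ _).trans (le_max_right _ _)))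
      ((hb h hh).mono hA'.le le_rfl hC'.le ((le_max_right _ _).trans (le_max_right _ _)))
    refine ⟨c, fun X => ?_, hc'⟩
    have := hc X
    rw [finrank_lam] at this
    simp only [ofReal_sigmaLam] at this
    exact this
  refine ⟨fun h hh X => ?_, D, hD, C₁, hC₁, fun h hh => ?_⟩
  · obtain ⟨c, hc, -⟩ := H' h hh
    exact ⟨_, hc X⟩
  · obtain ⟨c, hc, hc'⟩ := H' h hh
    have hcomp : ∀ p, weylComp Φ h (a h) (b h) (point Φ (ofReal2 p)) =
        1 / (Real.pi : ℂ) ^ (2 * n) * c (coord Φ p) := by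
      intro p
      have h0 : (h : ℂ) ≠ 0 := by exact_mod_cast hh.1.ne'
      have hpi : (Real.pi : ℂ) ≠ 0 := by exact_mod_cast Real.pi_ne_zero
      rw [weylComp, (hc _).eq, coord_apply]
      push_cast
      rw [mul_pow]
      field_simp
    simp only [hcomp]
    exact hc'
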